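/- \textbf{Setting.} Let $(M,g)$ be a smooth 4-dimensional Lorentzian manifold of signature $(-,+,+,+)$ with Levi-Civita connection $\nabla$, and let $t:M\to(0,\infty)$ be a smooth time function whose level sets $\Sigma_t$ are spacelike hypersurfaces such that the metric has zero shift, $g=-N^2\,dt\otimes dt+h$, where $N>0$ is smooth (the lapse) and $h$ is the family of induced metrics on the $\Sigma_t$. Let $\partial_t$ be the vector field orthogonal to the $\Sigma_t$ with $dt(\partial_t)=1$, let $e_0:=N^{-1}\partial_t$ be the future pointing unit normal, $k(X,Y):=g(\nabla_Xe_0,Y)$, for $X,Y$ tangent to the $\Sigma_t$, the second fundamental form, and $\theta:=\mathrm{tr}_hk$ the mean curvature. Assume that there are smooth vector fields $E_i$ and one forms $\eta^i$, $i=1,2,3$, on $M$ such that $[\partial_t,E_i]=0$, the $E_i$ are tangent to the $\Sigma_t$ and form a frame of each $\Sigma_t$, and the restrictions of the $\eta^i$ to the $\Sigma_t$ form the dual frame. Let $e_I$, $I=1,2,3$, be smooth vector fields on $M$, tangent to the $\Sigma_t$, that form an orthonormal frame with respect to $h$, with dual frame $\omega^I$, and write $e_I=e_I^iE_i$, $\omega^I=\omega^I_i\eta^i$,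 $k_{IJ}:=k(e_I,e_J)$, $\Gamma_{IJK}:=g(\nabla_{e_I}e_J,e_K)$. Let $\varphi\in C^\infty(M)$, $V\in C^\infty(\mathbb R)$, and let $\mathfrak a>0$ be a constant. Repeated capital indices are summed. \textbf{Proposition (reduced equations).} The following two statements are equivalent. (A) $(M,g,\varphi)$ solves the Einstein--nonlinear scalar field equations with potential $V$ (and zero cosmological constant), \[ \mathrm{Ric}_g-\tfrac12S_gg=d\varphi\otimes d\varphi-\big(\tfrac12g(d\varphi,d\varphi)+V\circ\varphi\big)g,\qquad \Box_g\varphi=V'\circ\varphi; \] the time function satisfies \[ \Box_g\ln t=\frac{\mathfrak a}{tN^2}\Big(N\theta-\frac1t\Big); \] and $\{e_I\}$ is a Fermi--Walker frame: $\nabla_{e_0}e_I=e_I(\ln N)e_0$. (B) The following system holds on $M$: \begin{align*} e_0(e_I^i)&=-k_{IJ}e_J^i,\qquad e_0(\omega^I_i)=k_{IJ}\omega^J_i,\qquad e_0N=(\mathfrak a+1)\Big(N\theta-\frac1t\Big),\\ e_0k_{IJ}&=-e_K\Gamma_{IJK}+e_I\Gamma_{KJK}+e_Ie_J(\ln N)-\theta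 k_{IJ}-\Gamma_{IJL}\Gamma_{KLK}+\Gamma_{KIL}\Gamma_{LJK}\\ &\quad+e_I(\ln N)e_J(\ln N)-\Gamma_{IJK}e_K(\ln N)+e_I(\varphi)e_J(\varphi)+(V\circ\varphi)\delta_{IJ},\\ e_0\Gamma_{IJK}&=e_Jk_{KI}-e_Kk_{JI}+k_{KL}\Gamma_{JLI}-k_{JL}\Gamma_{KLI}-k_{IL}\Gamma_{JKL}\\ &\quad+k_{IL}\Gamma_{KJL}-k_{IL}\Gamma_{LJK}+e_J(\ln N)k_{IK}-e_K(\ln N)k_{IJ},\\ e_0e_0\varphi&=e_Ie_I\varphi-\theta e_0\varphi-\Gamma_{IIJ}e_J\varphi+e_I(\varphi)e_I(\ln N)-V'\circ\varphi, \end{align*} together with the Hamiltonian and momentum constraints \begin{align*} 2e_K\Gamma_{IIK}+\Gamma_{IIL}\Gamma_{KLK}-\Gamma_{KIL}\Gamma_{LIK}+\theta^2-k_{IJ}k_{IJ}&=e_0(\varphi)^2+e_I(\varphi)e_I(\varphi)+2V\circ\varphi,\\ e_Jk_{JI}-\Gamma_{JJK}k_{KI}-\Gamma_{JIK}k_{JK}-e_I\theta&=e_0(\varphi)e_I(\varphi).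 \end{align*} -/

import Mathlib

open Manifold ContDiff Bundle VectorField FiberBundle

noncomputable section

/-- The model space of a 4-manifold. -/
abbrev E4 : Type := EuclideanSpace ℝ (Fin 4)

/-- Vector fields on a 4-manifold (not necessarily smooth). -/
abbrev VField (M : Type*) [TopologicalSpace M] [ChartedSpace E4 M] : Type _ :=
  Π x : M, TangentSpace (𝓡 4) x

section VectorFields

variable {M : Type*} [TopologicalSpace M] [ChartedSpace E4 M] [IsManifold (𝓡 4) ∞ M]

/-- The vector field `X` is smooth. -/
def VField.Smooth (X : VField M) : Prop :=
  ContMDiff (𝓡 4) ((𝓡 4).prod 𝓘(ℝ, E4)) ∞ (fun y ↦ (⟨y, X y⟩ : TotalSpace E4 (TangentSpace (𝓡 4) : M → Type _)))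

/-- The vector field `X` is differentiable at `x`. -/
abbrev VField.DiffAt (X : VField M) (x : M) : Prop :=
  MDifferentiableAt (𝓡 4) ((𝓡 4).prod 𝓘(ℝ, E4))
    (fun y ↦ (⟨y, X y⟩ : TotalSpace E4 (TangentSpace (𝓡 4) : M → Type _))) x

/-- The real function `f` is smooth on `M`. -/
abbrev SmoothFun (f : M → ℝ) : Prop := ContMDiff (𝓡 4) 𝓘(ℝ) ∞ f

/-- The derivative `X f` of the function `f` along the vector field `X`. -/
def VField.deriv (X : VField M) (f : M → ℝ) (x : M) : ℝ := mvfderiv (𝓡 4) f x (X x)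

/-- The Lie bracket of vector fields. -/
abbrev VField.bracket (X Y : VField M) : VField M := mlieBracket (𝓡 4) X Y

/-- The vector field near `x`, constant in the preferred trivialisation at `x`, with the given
value at `x`. It is smooth near `x`, and is used to evaluate tensors on tangent vectors. -/
abbrev VField.ext {x : M} (v : TangentSpace (𝓡 4) x) : VField M :=
  FiberBundle.extend E4 (E := (TangentSpace (𝓡 4) : M → Type _)) v

end VectorFields

/-- A smooth Lorentzian metric, of signature `(-,+,+,+)`, on a 4-manifold. -/
structure LorentzMetric (M : Type*) [TopologicalSpace M] [ChartedSpace E4 M]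
    [IsManifold (𝓡 4) ∞ M] where
  inner (x : M) : TangentSpace (𝓡 4) x →L[ℝ] TangentSpace (𝓡 4) x →L[ℝ] ℝ
  symm (x : M) (v w : TangentSpace (𝓡 4) x) : inner x v w = inner x w v
  lorentzian (x : M) : ∃ u : TangentSpace (𝓡 4) x, inner x u u < 0 ∧
    ∀ v : TangentSpace (𝓡 4) x, inner x u v = 0 → v ≠ 0 → 0 < inner x v v
  contMDiff : ContMDiff (𝓡 4) ((𝓡 4).prod 𝓘(ℝ, E4 →L[ℝ] E4 →L[ℝ] ℝ)) ∞
    (fun x ↦ TotalSpace.mk' (E4 →L[ℝ] E4 →L[ℝ] ℝ)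
      (E := fun x : M ↦ TangentSpace (𝓡 4) x →L[ℝ] TangentSpace (𝓡 4) x →L[ℝ] ℝ) x (inner x))

namespace LorentzMetric

variable {M : Type*} [TopologicalSpace M] [ChartedSpace E4 M]
  [IsManifold (𝓡 4) ∞ M] (g : LorentzMetric M)

/-- The function `g(X, Y)`. -/
def pair (X Y : VField M) (x : M) : ℝ := g.inner x (X x) (Y x)

/-- The metric at `x` as a bilinear form. -/
def bilin (x : M) : LinearMap.BilinForm ℝ (TangentSpace (𝓡 4) x) :=
  LinearMap.mk₂ ℝ (fun v w ↦ g.inner x v w) (by intros; simp) (by intros; simp)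
    (by intros; simp) (by intros; simp)

theorem eq_zero_of_inner_eq_zero {x : M} {v : TangentSpace (𝓡 4) x}
    (h : ∀ w, g.inner x v w = 0) : v = 0 := by
  by_contra hv
  obtain ⟨u, -, hpos⟩ := g.lorentzian x
  have h1 := hpos v (by rw [g.symm]; exact h u) hv
  rw [h v] at h1
  exact lt_irrefl _ h1

theorem bilin_nondegenerate (x : M) : (g.bilin x).Nondegenerate := by
  constructor
  · intro v hv
    exact g.eq_zero_of_inner_eq_zero hv
  · intro v hv
    exact g.eq_zero_of_inner_eq_zero (fun w ↦ by rw [g.symm]; exact hv w)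

instance finiteDimensional_tangentSpace (x : M) :
    FiniteDimensional ℝ (TangentSpace (𝓡 4) x) :=
  inferInstanceAs (FiniteDimensional ℝ E4)

instance t2Space_tangentSpace (x : M) : T2Space (TangentSpace (𝓡 4) x) :=
  inferInstanceAs (T2Space E4)

/-- The vector metrically equivalent to a covector: `g (sharp α) w = α w`. -/
def sharp (x : M) : (TangentSpace (𝓡 4) x →L[ℝ] ℝ) →ₗ[ℝ] TangentSpace (𝓡 4) x :=
  ((g.bilin x).toDual (g.bilin_nondegenerate x)).symm.toLinearMap ∘ₗ
    ContinuousLinearMap.coeLM ℝ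

theorem inner_sharp (x : M) (α : TangentSpace (𝓡 4) x →L[ℝ] ℝ) (w : TangentSpace (𝓡 4) x) :
    g.inner x (g.sharp x α) w = α w := by
  have := LinearMap.BilinForm.apply_toDual_symm_apply (B := g.bilin x)
    (hB := g.bilin_nondegenerate x) (α : TangentSpace (𝓡 4) x →ₗ[ℝ] ℝ) w
  exact this

theorem mdifferentiableAt_pair {x : M} {Y Z : VField M} (hY : Y.DiffAt x) (hZ : Z.DiffAt x) :
    MDifferentiableAt (𝓡 4) 𝓘(ℝ) (g.pair Y Z) x := by
  have : MDifferentiableAt (𝓡 4) ((𝓡 4).prod 𝓘(ℝ))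
      (fun m ↦ TotalSpace.mk' ℝ (E := Bundle.Trivial M ℝ) m (g.inner m (Y m) (Z m))) x := by
    apply MDifferentiableAt.clm_bundle_apply₂ (F₁ := E4) (F₂ := E4)
    · exact g.contMDiff.mdifferentiableAt (by simp)
    · exact hY
    · exact hZ
  simp only [mdifferentiableAt_totalSpace] at this
  exact this.2

theorem pair_add_left (X X' Y : VField M) : g.pair (X + X') Y = g.pair X Y + g.pair X' Y := by
  ext x; simp [pair]

theorem pair_smul_left (f : M → ℝ) (X Y : VField M) : g.pair (f • X) Y = f * g.pair X Y := by
  ext x; simp [pair]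

theorem pair_comm (X Y : VField M) : g.pair X Y = g.pair Y X := by
  ext x; exact g.symm x _ _

/-- The Koszul expression, which equals `2 g(∇_X Y, Z)`. -/
def koszul (X Y Z : VField M) (x : M) : ℝ :=
  X.deriv (g.pair Y Z) x + Y.deriv (g.pair X Z) x - Z.deriv (g.pair X Y) x
    + g.pair (X.bracket Y) Z x - g.pair (X.bracket Z) Y x - g.pair (Y.bracket Z) X x

theorem pair_add_right (X Y Y' : VField M) : g.pair X (Y + Y') = g.pair X Y + g.pair X Y' := by
  ext x; simp [pair]

theorem pair_smul_right (f : M → ℝ) (X Y : VField M) : g.pair X (f • Y) = f * g.pair X Y := by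
  ext x; simp [pair]

theorem koszul_tensorial_left {x : M} {Y Z : VField M} (hY : Y.DiffAt x) (hZ : Z.DiffAt x) :
    TensorialAt (𝓡 4) E4 (fun X : VField M ↦ g.koszul X Y Z x) x where
  smul {f X} hf hX := by
    have h1 := g.mdifferentiableAt_pair hX hZ
    have h2 := g.mdifferentiableAt_pair hX hY
    simp [koszul, pair_smul_left, VField.deriv, mvfderiv_mul hf h1, mvfderiv_mul hf h2]
    simp [pair, mlieBracket_smul_left hf hX]
    ring
  add {X X'} hX hX' := by
    have h1 := g.mdifferentiableAt_pair hX hZ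
    have h2 := g.mdifferentiableAt_pair hX hY
    have h1' := g.mdifferentiableAt_pair hX' hZ
    have h2' := g.mdifferentiableAt_pair hX' hY
    simp [koszul, pair_add_left, VField.deriv, mvfderiv_add h1 h1', mvfderiv_add h2 h2']
    simp [pair, mlieBracket_add_left hX hX']
    ring

theorem koszul_tensorial_right {x : M} {X Y : VField M} (hX : X.DiffAt x) (hY : Y.DiffAt x) :
    TensorialAt (𝓡 4) E4 (fun Z : VField M ↦ g.koszul X Y Z x) x where
  smul {f Z} hf hZ := by
    have h1 := g.mdifferentiableAt_pair hX hZ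
    have h2 := g.mdifferentiableAt_pair hY hZ
    simp [koszul, pair_smul_right, VField.deriv, mvfderiv_mul hf h1, mvfderiv_mul hf h2]
    simp [pair, mlieBracket_smul_right hf hZ, g.symm x (Z x)]
    ring
  add {Z Z'} hZ hZ' := by
    have h1 := g.mdifferentiableAt_pair hX hZ
    have h2 := g.mdifferentiableAt_pair hY hZ
    have h1' := g.mdifferentiableAt_pair hX hZ'
    have h2' := g.mdifferentiableAt_pair hY hZ'
    simp [koszul, pair_add_right, VField.deriv, mvfderiv_add h1 h1', mvfderiv_add h2 h2']
    simp [pair, mlieBracket_add_right hZ hZ']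
    ring

theorem koszul_add_mid {x : M} {X Y Y' Z : VField M} (hX : X.DiffAt x) (hY : Y.DiffAt x)
    (hY' : Y'.DiffAt x) (hZ : Z.DiffAt x) :
    g.koszul X (Y + Y') Z x = g.koszul X Y Z x + g.koszul X Y' Z x := by
  have h1 := g.mdifferentiableAt_pair hX hY
  have h2 := g.mdifferentiableAt_pair hY hZ
  have h1' := g.mdifferentiableAt_pair hX hY'
  have h2' := g.mdifferentiableAt_pair hY' hZ
  simp [koszul, pair_add_left, pair_add_right, VField.deriv, mvfderiv_add h1 h1',
    mvfderiv_add h2 h2']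
  simp [pair, mlieBracket_add_right hY hY', mlieBracket_add_left hY hY']
  ring

theorem koszul_smul_mid {x : M} {X Y Z : VField M} {f : M → ℝ}
    (hf : MDifferentiableAt (𝓡 4) 𝓘(ℝ) f x)
    (hX : X.DiffAt x) (hY : Y.DiffAt x) (hZ : Z.DiffAt x) :
    g.koszul X (f • Y) Z x = f x * g.koszul X Y Z x + 2 * X.deriv f x * g.pair Y Z x := by
  have h1 := g.mdifferentiableAt_pair hX hY
  have h2 := g.mdifferentiableAt_pair hY hZ
  simp [koszul, pair_smul_left, pair_smul_right, VField.deriv, mvfderiv_mul hf h1,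
    mvfderiv_mul hf h2]
  simp [pair, mlieBracket_smul_right hf hY, mlieBracket_smul_left hf hY]
  rw [g.symm x (Y x) (X x)]
  ring

theorem diffAt_ext {x : M} (v : TangentSpace (𝓡 4) x) : (VField.ext v).DiffAt x :=
  mdifferentiableAt_extend ..

/-- For `Y` differentiable at `x`, the bilinear form `(v, w) ↦ 2 g(∇_v Y, w)`. -/
def koszulForm {Y : VField M} {x : M} (hY : Y.DiffAt x) :
    TangentSpace (𝓡 4) x →L[ℝ] TangentSpace (𝓡 4) x →L[ℝ] ℝ :=
  TensorialAt.mkHom₂ (I := 𝓡 4) (F := E4) (F' := E4)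
    (fun X Z : VField M ↦ g.koszul X Y Z x) x
    (fun _ hZ ↦ g.koszul_tensorial_left hY hZ) (fun _ hX ↦ g.koszul_tensorial_right hX hY)

theorem koszulForm_apply {X Y Z : VField M} {x : M} (hX : X.DiffAt x) (hY : Y.DiffAt x)
    (hZ : Z.DiffAt x) : g.koszulForm hY (X x) (Z x) = g.koszul X Y Z x :=
  TensorialAt.mkHom₂_apply _ _ hX hZ

open Classical in
/-- The Levi-Civita derivative of `Y` at `x`, as the linear map `v ↦ ∇_v Y` given by the Koszul
formula (zero if `Y` is not differentiable at `x`). -/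
def covAt (Y : VField M) (x : M) : TangentSpace (𝓡 4) x →L[ℝ] TangentSpace (𝓡 4) x :=
  if hY : Y.DiffAt x then
    LinearMap.toContinuousLinearMap
      ((1 / 2 : ℝ) • (g.sharp x ∘ₗ (g.koszulForm hY).toLinearMap))
  else 0

theorem two_inner_covAt {X Y Z : VField M} {x : M} (hX : X.DiffAt x) (hY : Y.DiffAt x)
    (hZ : Z.DiffAt x) : 2 * g.inner x (g.covAt Y x (X x)) (Z x) = g.koszul X Y Z x := by
  rw [← g.koszulForm_apply hX hY hZ]
  simp [covAt, hY, inner_sharp]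

/-- The Levi-Civita connection of `g`; `g.leviCivita Y x v` is `∇_v Y`. -/
def leviCivita : CovariantDerivative (𝓡 4) E4 (TangentSpace (𝓡 4) : M → Type _) where
  toFun := g.covAt
  isCovariantDerivativeOnUniv :=
    { add := by
        intro Y Y' x hY hY' _
        ext1 v
        refine sub_eq_zero.1 (g.eq_zero_of_inner_eq_zero fun w ↦ ?_)
        have hs : VField.DiffAt (Y + Y') x := mdifferentiableAt_add_section hY hY'
        have h := g.koszul_add_mid (diffAt_ext v) hY hY' (diffAt_ext w)
        rw [← g.two_inner_covAt (diffAt_ext v) hY (diffAt_ext w),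
          ← g.two_inner_covAt (diffAt_ext v) hY' (diffAt_ext w),
          ← g.two_inner_covAt (diffAt_ext v) hs (diffAt_ext w)] at h
        simp at h ⊢
        linarith
      leibniz := by
        intro Y f x hY hf _
        ext1 v
        refine sub_eq_zero.1 (g.eq_zero_of_inner_eq_zero fun w ↦ ?_)
        have hs : VField.DiffAt (f • Y) x := hf.smul_section hY
        have h := g.koszul_smul_mid hf (diffAt_ext v) hY (diffAt_ext w)
        rw [← g.two_inner_covAt (diffAt_ext v) hY (diffAt_ext w),
          ← g.two_inner_covAt (diffAt_ext v) hs (diffAt_ext w)] at h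
        simp [pair, VField.deriv] at h ⊢
        linarith }

/-- The vector field `∇_X Y`. -/
def nabla (X Y : VField M) : VField M := fun x ↦ g.leviCivita Y x (X x)

/-- The Levi-Civita connection is torsion free. -/
theorem nabla_sub_nabla {X Y : VField M} {x : M} (hX : X.DiffAt x) (hY : Y.DiffAt x) :
    g.nabla X Y x - g.nabla Y X x = X.bracket Y x := by
  refine sub_eq_zero.1 (g.eq_zero_of_inner_eq_zero fun w ↦ ?_)
  have h1 := g.two_inner_covAt hX hY (diffAt_ext w)
  have h2 := g.two_inner_covAt hY hX (diffAt_ext w)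
  have h3 : mlieBracket (𝓡 4) Y X x = - mlieBracket (𝓡 4) X Y x := mlieBracket_swap_apply
  simp only [koszul, g.pair_comm Y X] at h1 h2
  simp [pair, h3] at h1 h2
  simp [nabla, leviCivita]
  linarith

/-- The Levi-Civita connection is compatible with the metric. -/
theorem deriv_pair {X Y Z : VField M} {x : M} (hX : X.DiffAt x) (hY : Y.DiffAt x)
    (hZ : Z.DiffAt x) :
    X.deriv (g.pair Y Z) x = g.pair (g.nabla X Y) Z x + g.pair Y (g.nabla X Z) x := by
  have h1 := g.two_inner_covAt hX hY hZ
  have h2 := g.two_inner_covAt hX hZ hY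
  have h3 : mlieBracket (𝓡 4) Z Y x = - mlieBracket (𝓡 4) Y Z x := mlieBracket_swap_apply
  simp only [koszul, g.pair_comm Z Y] at h1 h2
  simp [pair, h3] at h1 h2
  simp [pair, nabla, leviCivita]
  rw [g.symm x (Y x)]
  linarith

/-- The Riemann curvature `R(X,Y)Z = ∇_X ∇_Y Z - ∇_Y ∇_X Z - ∇_[X,Y] Z`. -/
def riemann (X Y Z : VField M) : VField M := fun x ↦
  g.nabla X (g.nabla Y Z) x - g.nabla Y (g.nabla X Z) x - g.nabla (X.bracket Y) Z x

/-- The trace `g^{ij} A(b_i, b_j)` of a bilinear form `A` on the span of the linearly independent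
vectors `b_i`, where `g^{ij}` is the inverse of the matrix `g(b_i, b_j)`. -/
def metricTrace {n : ℕ} {x : M} (b : Fin n → TangentSpace (𝓡 4) x)
    (A : TangentSpace (𝓡 4) x → TangentSpace (𝓡 4) x → ℝ) : ℝ :=
  ∑ i, ∑ j, (Matrix.of fun i j ↦ g.inner x (b i) (b j))⁻¹ i j * A (b i) (b j)

/-- The standard basis of the tangent space (any basis would do: it is used in traces only). -/
def stdBasis (x : M) (i : Fin 4) : TangentSpace (𝓡 4) x := EuclideanSpace.basisFun (Fin 4) ℝ i

/-- The trace with respect to `g` of a bilinear form on the tangent space at `x`. -/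
def trace (x : M) (A : TangentSpace (𝓡 4) x → TangentSpace (𝓡 4) x → ℝ) : ℝ :=
  g.metricTrace (stdBasis x) A

/-- The Ricci tensor `Ric(u, v)`, the trace of `z ↦ R(z, u)v`. -/
def ricci (x : M) (u v : TangentSpace (𝓡 4) x) : ℝ :=
  g.trace x fun z w ↦ g.inner x (g.riemann (.ext z) (.ext u) (.ext v) x) w

/-- The scalar curvature. -/
def scalarCurvature (x : M) : ℝ := g.trace x (g.ricci x)

/-- The gradient of a function. -/
def grad (f : M → ℝ) : VField M := fun x ↦ g.sharp x (mvfderiv (𝓡 4) f x)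

/-- The wave operator: the trace of the Hessian `(z, w) ↦ g(∇_z grad f, w)`. -/
def box (f : M → ℝ) (x : M) : ℝ :=
  g.trace x fun z w ↦ g.inner x (g.leviCivita (g.grad f) x z) w

/-- The energy-momentum tensor `dφ ⊗ dφ - (g(dφ, dφ) / 2 + V ∘ φ) g` of a scalar field. -/
def energyMomentum (V : ℝ → ℝ) (φ : M → ℝ) (x : M) (u v : TangentSpace (𝓡 4) x) : ℝ :=
  mvfderiv (𝓡 4) φ x u * mvfderiv (𝓡 4) φ x v
    - (1 / 2 * g.inner x (g.grad φ x) (g.grad φ x) + V (φ x)) * g.inner x u v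

/-- `(M, g, φ)` solves the Einstein--nonlinear scalar field equations with potential `V`
(and vanishing cosmological constant). -/
structure SolvesENSF (V : ℝ → ℝ) (φ : M → ℝ) : Prop where
  einstein (x : M) (u v : TangentSpace (𝓡 4) x) :
    g.ricci x u v - 1 / 2 * g.scalarCurvature x * g.inner x u v = g.energyMomentum V φ x u v
  wave (x : M) : g.box φ x = _root_.deriv V (φ x)

end LorentzMetric

/-- A foliation with zero shift by the level sets of a positive time function `t`, with lapse `N`,
so that `g = -N² dt ⊗ dt + h`, with `h` the induced metrics on the level sets. The vector field
`∂_t` is the one with `dt(∂_t) = 1` that is orthogonal to the level sets. -/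
structure ZeroShiftFoliation {M : Type*} [TopologicalSpace M] [ChartedSpace E4 M]
    [IsManifold (𝓡 4) ∞ M] (g : LorentzMetric M) where
  t : M → ℝ
  N : M → ℝ
  partialT : VField M
  t_smooth : SmoothFun t
  N_smooth : SmoothFun N
  partialT_smooth : partialT.Smooth
  t_pos (x : M) : 0 < t x
  N_pos (x : M) : 0 < N x
  deriv_partialT (x : M) : partialT.deriv t x = 1
  /-- `g(∂_t, ·) = -N² dt`. -/
  inner_partialT (x : M) (v : TangentSpace (𝓡 4) x) :
    g.inner x (partialT x) v = -(N x) ^ 2 * mvfderiv (𝓡 4) t x v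
  /-- The level sets are spacelike. -/
  spacelike (x : M) (v : TangentSpace (𝓡 4) x) :
    mvfderiv (𝓡 4) t x v = 0 → v ≠ 0 → 0 < g.inner x v v

/-- A time independent reference frame `E_i` for the leaves of the foliation, with one forms
`η^i` that restrict to the dual frame on the leaves. -/
structure ReferenceFrame {M : Type*} [TopologicalSpace M] [ChartedSpace E4 M]
    [IsManifold (𝓡 4) ∞ M] {g : LorentzMetric M} (F : ZeroShiftFoliation g) where
  E : Fin 3 → VField M
  η : Fin 3 → Π x : M, TangentSpace (𝓡 4) x →L[ℝ] ℝ
  smooth (i : Fin 3) : (E i).Smooth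
  tangent (i : Fin 3) (x : M) : (E i).deriv F.t x = 0
  linearIndependent (x : M) : LinearIndependent ℝ fun i ↦ E i x
  commute (i : Fin 3) (x : M) : F.partialT.bracket (E i) x = 0
  dual (i j : Fin 3) (x : M) : η i x (E j x) = if i = j then 1 else 0

/-- Smooth vector fields `e_I` tangent to the leaves that form an orthonormal frame for the
induced metrics, with one forms `ω^I` that restrict to the dual frame on the leaves. -/
structure OrthonormalFrame {M : Type*} [TopologicalSpace M] [ChartedSpace E4 M]
    [IsManifold (𝓡 4) ∞ M] {g : LorentzMetric M} (F : ZeroShiftFoliation g) where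
  e : Fin 3 → VField M
  coframe : Fin 3 → Π x : M, TangentSpace (𝓡 4) x →L[ℝ] ℝ
  smooth (I : Fin 3) : (e I).Smooth
  tangent (I : Fin 3) (x : M) : (e I).deriv F.t x = 0
  orthonormal (I J : Fin 3) (x : M) : g.pair (e I) (e J) x = if I = J then 1 else 0
  dual (I J : Fin 3) (x : M) : coframe I x (e J x) = if I = J then 1 else 0

section Foliation

variable {M : Type*} [TopologicalSpace M] [ChartedSpace E4 M]
  [IsManifold (𝓡 4) ∞ M] {g : LorentzMetric M} {F : ZeroShiftFoliation g}

variable (F) in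
/-- The future pointing unit normal `e_0 = N⁻¹ ∂_t` of the leaves. -/
def ZeroShiftFoliation.normal : VField M := fun x ↦ (F.N x)⁻¹ • F.partialT x

variable (F) in
/-- The function `ln N`. -/
def ZeroShiftFoliation.lnN (x : M) : ℝ := Real.log (F.N x)

variable (F) in
/-- The second fundamental form `k(u, v) = g(∇_u e_0, v)` of the leaves. -/
def ZeroShiftFoliation.k (x : M) (u v : TangentSpace (𝓡 4) x) : ℝ :=
  g.inner x (g.leviCivita F.normal x u) v

/-- The mean curvature `θ = tr_h k` of the leaves. -/
def ReferenceFrame.θ (R : ReferenceFrame F) (x : M) : ℝ :=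
  g.metricTrace (fun i ↦ R.E i x) (F.k x)

/-- The time function satisfies `□ ln t = 𝔞 / (t N²) (N θ - 1 / t)`. -/
def ReferenceFrame.TimeEquation (R : ReferenceFrame F) (𝔞 : ℝ) : Prop :=
  ∀ x, g.box (fun y ↦ Real.log (F.t y)) x =
    𝔞 / (F.t x * F.N x ^ 2) * (F.N x * R.θ x - 1 / F.t x)

namespace OrthonormalFrame

variable (e : OrthonormalFrame F)

/-- The frame satisfies the Fermi--Walker transport equation `∇_{e_0} e_I = e_I(ln N) e_0`. -/
def IsFermiWalker : Prop :=
  ∀ I x, g.nabla F.normal (e.e I) x = (e.e I).deriv F.lnN x • F.normal x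

/-- The derivative of a function in the direction of `e_I`. -/
def D (I : Fin 3) (f : M → ℝ) : M → ℝ := (e.e I).deriv f

/-- The components `k_{IJ} = k(e_I, e_J)`. -/
def k (I J : Fin 3) (x : M) : ℝ := F.k x (e.e I x) (e.e J x)

/-- The connection coefficients `Γ_{IJK} = g(∇_{e_I} e_J, e_K)`. -/
def Γ (I J K : Fin 3) : M → ℝ := g.pair (g.nabla (e.e I) (e.e J)) (e.e K)

/-- The components `e_I^i` of `e_I = e_I^i E_i`. -/
def frameCoeff (R : ReferenceFrame F) (I i : Fin 3) (x : M) : ℝ := R.η i x (e.e I x)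

/-- The components `ω^I_i` of `ω^I = ω^I_i η^i`. -/
def coframeCoeff (R : ReferenceFrame F) (I i : Fin 3) (x : M) : ℝ := e.coframe I x (R.E i x)

/-- The reduced first order system. Here `e.D I` and `F.normal.deriv` are the derivatives along
`e_I` and `e_0`. -/
structure ReducedEquations (R : ReferenceFrame F) (𝔞 : ℝ) (V : ℝ → ℝ) (φ : M → ℝ) : Prop where
  frame (I i : Fin 3) (x : M) : F.normal.deriv (e.frameCoeff R I i) x =
    -∑ J, e.k I J x * e.frameCoeff R J i x
  coframe (I i : Fin 3) (x : M) : F.normal.deriv (e.coframeCoeff R I i) x =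
    ∑ J, e.k I J x * e.coframeCoeff R J i x
  lapse (x : M) : F.normal.deriv F.N x = (𝔞 + 1) * (F.N x * R.θ x - 1 / F.t x)
  evolution_k (I J : Fin 3) (x : M) : F.normal.deriv (e.k I J) x =
    -(∑ K, e.D K (e.Γ I J K) x) + (∑ K, e.D I (e.Γ K J K) x) + e.D I (e.D J F.lnN) x
      - R.θ x * e.k I J x
      - (∑ K, ∑ L, e.Γ I J L x * e.Γ K L K x) + (∑ K, ∑ L, e.Γ K I L x * e.Γ L J K x)
      + e.D I F.lnN x * e.D J F.lnN x - (∑ K, e.Γ I J K x * e.D K F.lnN x)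
      + e.D I φ x * e.D J φ x + V (φ x) * (if I = J then 1 else 0)
  evolution_Γ (I J K : Fin 3) (x : M) : F.normal.deriv (e.Γ I J K) x =
    e.D J (e.k K I) x - e.D K (e.k J I) x
      + (∑ L, e.k K L x * e.Γ J L I x) - (∑ L, e.k J L x * e.Γ K L I x)
      - (∑ L, e.k I L x * e.Γ J K L x) + (∑ L, e.k I L x * e.Γ K J L x)
      - (∑ L, e.k I L x * e.Γ L J K x)
      + e.D J F.lnN x * e.k I K x - e.D K F.lnN x * e.k I J x
  wave (x : M) : F.normal.deriv (F.normal.deriv φ) x =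
    (∑ I, e.D I (e.D I φ) x) - R.θ x * F.normal.deriv φ x
      - (∑ I, ∑ J, e.Γ I I J x * e.D J φ x) + (∑ I, e.D I φ x * e.D I F.lnN x)
      - deriv V (φ x)
  hamiltonian (x : M) :
    2 * (∑ I, ∑ K, e.D K (e.Γ I I K) x)
      + (∑ I, ∑ K, ∑ L, e.Γ I I L x * e.Γ K L K x)
      - (∑ I, ∑ K, ∑ L, e.Γ K I L x * e.Γ L I K x)
      + R.θ x ^ 2 - (∑ I, ∑ J, e.k I J x * e.k I J x) =
    F.normal.deriv φ x ^ 2 + (∑ I, e.D I φ x * e.D I φ x) + 2 * V (φ x)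
  momentum (I : Fin 3) (x : M) :
    (∑ J, e.D J (e.k J I) x) - (∑ J, ∑ K, e.Γ J J K x * e.k K I x)
      - (∑ J, ∑ K, e.Γ J I K x * e.k J K x) - e.D I R.θ x =
    F.normal.deriv φ x * e.D I φ x

end OrthonormalFrame

end Foliation

end

/-! The orthonormal frame `e_0, e_1, e_2, e_3` turns all geometry into the functions `g(∇_a b_c,
b_d)`, antisymmetric in the last two slots. For a frame adapted to the leaves these are `k_{IJ}`
(symmetric, because the leaves are integrable), `Γ_{IJK}`, `e_I(ln N)` (forced by the bracket `[e_0,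
e_I]` acting on `t`) and the rotation `g(∇_{e_0} e_I, e_J)`. Only the rotation records the choice of
time propagation, and Fermi--Walker means exactly that it vanishes (`isFermiWalker_iff`).

Each reduced equation is then either an identity or one component of a condition in (A). Since
`[∂_t, E_i] = 0`, differentiating `g(E_i, e_I)` along `e_0` produces `k` plus the rotation, so the
equation for `e_I^i` is equivalent to Fermi--Walker (`isFermiWalker_iff_frame`), and the one for
`ω^I_i` follows. Computing `□ ln t` gives the lapse equation (`timeEquation_iff`). The equation for
`Γ` is the pair symmetry `R(0,I,J,K) = R(J,K,0,I)` written out, with no field equation used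
(`deriv_Γ_normal`). The right-hand side for `e_0 k_{IJ}` is exact up to `Ric_{IJ}`
(`deriv_k_normal`). The left-hand sides of the constraints are `Ric_{00} + Σ Ric_{II}` (`gauss`) and
`Ric_{I0}` (`codazzi`).

In dimension four Einstein's equations are equivalent to `Ric = dφ ⊗ dφ + (V ∘ φ) g`
(`einstein_iff`). Its `IJ`, `00` and `0I` components are thus the evolution of `k` and the two
constraints, where `Ric_{00}` is recovered from the Hamiltonian constraint by subtracting the
spatial trace. -/

set_option linter.unusedSectionVars false

noncomputable section

/-! ### Smoothness at a point, derivations and Lie brackets. -/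

section SmoothAt

variable {M : Type*} [TopologicalSpace M] [ChartedSpace E4 M] [IsManifold (𝓡 4) ∞ M]

/-- The vector field `X` is smooth at `x`. -/
abbrev VField.SmoothAt (X : VField M) (x : M) : Prop :=
  ContMDiffAt (𝓡 4) ((𝓡 4).prod 𝓘(ℝ, E4)) ∞
    (fun y ↦ (⟨y, X y⟩ : TotalSpace E4 (TangentSpace (𝓡 4) : M → Type _))) x

/-- The real function `f` is smooth at `x`. -/
abbrev SmoothFunAt (f : M → ℝ) (x : M) : Prop := ContMDiffAt (𝓡 4) 𝓘(ℝ) ∞ f x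

theorem VField.SmoothAt.diffAt {X : VField M} {x : M} (hX : X.SmoothAt x) : X.DiffAt x :=
  hX.mdifferentiableAt (by simp)

theorem SmoothFunAt.mdiff {f : M → ℝ} {x : M} (hf : SmoothFunAt f x) :
    MDifferentiableAt (𝓡 4) 𝓘(ℝ) f x :=
  ContMDiffAt.mdifferentiableAt hf (by simp)

/-- The curvature is evaluated on such extensions, which are controlled only near `x`; hence
smoothness at a point is the working notion below. -/
theorem VField.smoothAt_ext {x : M} (v : TangentSpace (𝓡 4) x) : (VField.ext v).SmoothAt x :=
  contMDiffAt_extend ..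

/-- The rules for `∇_X Y` need `Y` differentiable at the point in question, so second covariant
derivatives at `x` need differentiability in a neighbourhood. Smoothness is lowered to `C^1` because
`C^∞` at a point provides a neighbourhood for each finite order only. -/
theorem VField.SmoothAt.eventually_diffAt {X : VField M} {x : M} (hX : X.SmoothAt x) :
    ∀ᶠ y in nhds x, X.DiffAt y := by
  have h1 : ContMDiffAt (𝓡 4) ((𝓡 4).prod 𝓘(ℝ, E4)) 1
    (fun y ↦ (⟨y, X y⟩ : TotalSpace E4 (TangentSpace (𝓡 4) : M → Type _))) x := hX.of_le (by simp)
  filter_upwards [(contMDiffAt_iff_contMDiffAt_nhds (by simp)).1 h1] with y hy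
  exact hy.mdifferentiableAt (by simp)

theorem SmoothFunAt.eventually_mdiff {f : M → ℝ} {x : M} (hf : SmoothFunAt f x) :
    ∀ᶠ y in nhds x, MDifferentiableAt (𝓡 4) 𝓘(ℝ) f y := by
  have h1 : ContMDiffAt (𝓡 4) 𝓘(ℝ) 1 f x := ContMDiffAt.of_le hf (by simp)
  filter_upwards [(contMDiffAt_iff_contMDiffAt_nhds (by simp)).1 h1] with y hy
  exact hy.mdifferentiableAt (by simp)

/-- The pair `(f, df(X))` is smooth into the tangent bundle of `ℝ`; the claim is its fibre
component. -/
theorem VField.SmoothAt.deriv {X : VField M} {f : M → ℝ} {x : M} (hX : X.SmoothAt x)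
    (hf : SmoothFunAt f x) : SmoothFunAt (X.deriv f) x := by
  have : ContMDiffAt (𝓡 4) (𝓘(ℝ).prod 𝓘(ℝ)) ∞
      (fun y ↦ (⟨f y, mfderiv (𝓡 4) 𝓘(ℝ) f y (X y)⟩ : TangentBundle 𝓘(ℝ) ℝ)) x := by
    have h := ContMDiffAt.mfderiv_const (m := ∞) hf (by simp)
    exact ContMDiffAt.clm_apply_of_inCoordinates (E₁ := (TangentSpace (𝓡 4) : M → Type _))
      (E₂ := (TangentSpace 𝓘(ℝ) : ℝ → Type _)) h hX hf
  exact (contMDiff_snd_tangentBundle_modelSpace ℝ 𝓘(ℝ)).contMDiffAt.comp x this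

theorem VField.SmoothAt.bracket {X Y : VField M} {x : M} (hX : X.SmoothAt x)
    (hY : Y.SmoothAt x) : (X.bracket Y).SmoothAt x := by
  have : IsManifold (𝓡 4) (((⊤ : ℕ∞) : ℕ∞ω) + 1) M := by simpa
  have : IsManifold (𝓡 4) (minSmoothness ℝ 2) M := by
    simp only [minSmoothness_of_isRCLikeNormedField]
    exact IsManifold.of_le (n := ∞) (WithTop.coe_le_coe.2 le_top)
  exact ContMDiffAt.mlieBracket_vectorField (m := ⊤) (n := ⊤) hX hY (by simp)

theorem LorentzMetric.smoothFunAt_pair (g : LorentzMetric M) {X Y : VField M} {x : M}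
    (hX : X.SmoothAt x) (hY : Y.SmoothAt x) : SmoothFunAt (g.pair X Y) x := by
  have : ContMDiffAt (𝓡 4) ((𝓡 4).prod 𝓘(ℝ)) ∞
      (fun m ↦ TotalSpace.mk' ℝ (E := Bundle.Trivial M ℝ) m (g.inner m (X m) (Y m))) x := by
    apply ContMDiffAt.clm_bundle_apply₂ (F₁ := E4) (F₂ := E4)
    · exact g.contMDiff x
    · exact hX
    · exact hY
  rw [contMDiffAt_totalSpace] at this
  exact this.2

theorem SmoothFunAt.const (c : ℝ) (x : M) : SmoothFunAt (fun _ ↦ c) x := contMDiffAt_const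

theorem SmoothFunAt.add {f h : M → ℝ} {x : M} (hf : SmoothFunAt f x) (hh : SmoothFunAt h x) :
    SmoothFunAt (f + h) x := ContMDiffAt.add hf hh

theorem SmoothFunAt.sub {f h : M → ℝ} {x : M} (hf : SmoothFunAt f x) (hh : SmoothFunAt h x) :
    SmoothFunAt (f - h) x := ContMDiffAt.sub hf hh

theorem SmoothFunAt.mul {f h : M → ℝ} {x : M} (hf : SmoothFunAt f x) (hh : SmoothFunAt h x) :
    SmoothFunAt (f * h) x := ContMDiffAt.mul hf hh

theorem SmoothFunAt.inv {f : M → ℝ} {x : M} (hf : SmoothFunAt f x) (h0 : f x ≠ 0) :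
    SmoothFunAt (fun y ↦ (f y)⁻¹) x :=
  (contDiffAt_inv ℝ h0).contMDiffAt.comp x hf

theorem SmoothFunAt.log {f : M → ℝ} {x : M} (hf : SmoothFunAt f x) (h0 : f x ≠ 0) :
    SmoothFunAt (fun y ↦ Real.log (f y)) x :=
  (Real.contDiffAt_log.2 h0).contMDiffAt.comp x hf

theorem SmoothFunAt.sum {ι : Type*} {s : Finset ι} {f : ι → M → ℝ} {x : M}
    (hf : ∀ i ∈ s, SmoothFunAt (f i) x) : SmoothFunAt (fun y ↦ ∑ i ∈ s, f i y) x :=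
  ContMDiffAt.sum hf

namespace VField

variable {X Y Z : VField M} {f h : M → ℝ} {x : M}

theorem deriv_add' (hf : SmoothFunAt f x) (hh : SmoothFunAt h x) :
    X.deriv (fun y ↦ f y + h y) x = X.deriv f x + X.deriv h x := by
  have := mvfderiv_add hf.mdiff hh.mdiff
  exact congrArg (fun l ↦ l (X x)) this

theorem deriv_neg : X.deriv (fun y ↦ -f y) x = -X.deriv f x := by
  have := mvfderiv_neg (I := 𝓡 4) (g := f) (x := x)
  exact congrArg (fun l ↦ l (X x)) this

theorem deriv_const (c : ℝ) : X.deriv (fun _ ↦ c) x = 0 := by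
  simp [VField.deriv, mvfderiv_const]

theorem deriv_mul (hf : SmoothFunAt f x) (hh : SmoothFunAt h x) :
    X.deriv (fun y ↦ f y * h y) x = f x * X.deriv h x + h x * X.deriv f x := by
  have := mvfderiv_mul hf.mdiff hh.mdiff
  have := congrArg (fun l ↦ l (X x)) this
  simpa using! this

theorem deriv_comp {F : ℝ → ℝ} {F' : ℝ} (hF : HasDerivAt F F' (f x)) (hf : SmoothFunAt f x) :
    X.deriv (fun y ↦ F (f y)) x = F' * X.deriv f x := by
  have h1 := mvfderiv_comp_apply x hF.differentiableAt.mdifferentiableAt hf.mdiff (X x)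
  have h2 : mvfderiv 𝓘(ℝ) F (f x) = fderiv ℝ F (f x) := by
    rw [mvfderiv, mfderiv_eq_fderiv]; rfl
  unfold VField.deriv
  refine h1.trans ?_
  rw [h2, hF.hasFDerivAt.fderiv]
  exact mul_comm _ _

theorem deriv_sum {ι : Type*} {s : Finset ι} {f : ι → M → ℝ}
    (hf : ∀ i ∈ s, SmoothFunAt (f i) x) :
    X.deriv (fun y ↦ ∑ i ∈ s, f i y) x = ∑ i ∈ s, X.deriv (f i) x := by
  classical
  induction s using Finset.induction_on with
  | empty => simpa using deriv_const 0
  | insert a s ha ih =>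
    have hs : ∀ i ∈ s, SmoothFunAt (f i) x := fun i hi ↦ hf i (Finset.mem_insert_of_mem hi)
    simp only [Finset.sum_insert ha]
    rw [deriv_add' (hf a (Finset.mem_insert_self a s)) (SmoothFunAt.sum hs), ih hs]

theorem SmoothAt.add (hX : X.SmoothAt x) (hY : Y.SmoothAt x) : (X + Y).SmoothAt x :=
  ContMDiffAt.add_section hX hY

theorem SmoothAt.smul (hX : X.SmoothAt x) (hf : SmoothFunAt f x) : (f • X).SmoothAt x :=
  ContMDiffAt.smul_section hf hX

theorem SmoothAt.sum {ι : Type*} {s : Finset ι} {X : ι → VField M}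
    (hX : ∀ i ∈ s, (X i).SmoothAt x) : VField.SmoothAt (fun y ↦ ∑ i ∈ s, X i y) x :=
  ContMDiffAt.sum_section hX

theorem SmoothAt.congr (hX : X.SmoothAt x) (h : ∀ᶠ y in nhds x, Y y = X y) : Y.SmoothAt x :=
  ContMDiffAt.congr_of_eventuallyEq hX (by filter_upwards [h] with y hy; simp [hy])

theorem jacobi (hX : X.SmoothAt x) (hY : Y.SmoothAt x) (hZ : Z.SmoothAt x) :
    X.bracket (Y.bracket Z) x = (X.bracket Y).bracket Z x + Y.bracket (X.bracket Z) x := by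
  have : IsManifold (𝓡 4) (minSmoothness ℝ 3) M := by
    simp only [minSmoothness_of_isRCLikeNormedField]
    exact IsManifold.of_le (n := ∞) (WithTop.coe_le_coe.2 le_top)
  have h2 : minSmoothness ℝ 2 ≤ (∞ : ℕ∞ω) := by
    simp only [minSmoothness_of_isRCLikeNormedField]
    exact WithTop.coe_le_coe.2 le_top
  exact leibniz_identity_mlieBracket_apply (hX.of_le h2) (hY.of_le h2) (hZ.of_le h2)

theorem bracket_smul_right (hf : SmoothFunAt f x) (hY : Y.SmoothAt x) :
    X.bracket (f • Y) x = X.deriv f x • Y x + f x • X.bracket Y x :=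
  mlieBracket_smul_right hf.mdiff hY.diffAt

theorem bracket_add_right (hY : Y.SmoothAt x) (hZ : Z.SmoothAt x) :
    X.bracket (Y + Z) x = X.bracket Y x + X.bracket Z x :=
  mlieBracket_add_right hY.diffAt hZ.diffAt

theorem bracket_congr_right (h : Y =ᶠ[nhds x] Z) : X.bracket Y x = X.bracket Z x :=
  Filter.EventuallyEq.mlieBracket_vectorField_eq .rfl h

/-- The Lie bracket acts on functions as the commutator of derivations, in the presence of a
smooth vector field that does not vanish at the point. -/
theorem deriv_bracket (hX : X.SmoothAt x) (hY : Y.SmoothAt x) (hZ : Z.SmoothAt x)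
    (hZ0 : Z x ≠ 0) (hf : SmoothFunAt f x) :
    (X.bracket Y).deriv f x = X.deriv (Y.deriv f) x - Y.deriv (X.deriv f) x := by
  have key : ∀ {X Y : VField M}, X.SmoothAt x → Y.SmoothAt x →
      X.bracket (Y.bracket (f • Z)) x = X.deriv (Y.deriv f) x • Z x + Y.deriv f x • X.bracket Z x
        + X.deriv f x • Y.bracket Z x + f x • X.bracket (Y.bracket Z) x := by
    intro X Y hX hY
    have h1 : Y.bracket (f • Z) =ᶠ[nhds x] (Y.deriv f) • Z + f • Y.bracket Z := by
      filter_upwards [hf.eventually_mdiff, hZ.eventually_diffAt] with y hy hy'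
      rw [VField.bracket, mlieBracket_smul_right hy hy']
      rfl
    rw [bracket_congr_right h1, bracket_add_right (hZ.smul (hY.deriv hf)) ((hY.bracket hZ).smul hf),
      bracket_smul_right (hY.deriv hf) hZ, bracket_smul_right hf (hY.bracket hZ)]
    abel
  -- In the Jacobi identity for `X, Y, f Z`, the Jacobi identity for `X, Y, Z` and the first-order
  -- terms cancel. What is left is a multiple of `Z x ≠ 0`, whose coefficient must vanish.
  have h := jacobi hX hY (hZ.smul hf)
  rw [key hX hY, key hY hX, bracket_smul_right hf hZ, jacobi hX hY hZ] at h
  have h' : ((X.bracket Y).deriv f x - (X.deriv (Y.deriv f) x - Y.deriv (X.deriv f) x)) • Z x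
      = 0 := by
    rw [smul_add, ← sub_eq_zero] at h
    rw [← neg_eq_zero, ← h]
    module
  have := (smul_eq_zero.1 h').resolve_right hZ0
  linarith

end VField

end SmoothAt

/-! ### Orthonormal frames: traces, expansions and smoothness. -/

section Frame

variable {M : Type*} [TopologicalSpace M] [ChartedSpace E4 M] [IsManifold (𝓡 4) ∞ M]

namespace LorentzMetric

/-- The trace over the span of linearly independent vectors `p i` may be computed in an
orthonormal basis of this span. -/
theorem metricTrace_eq_sum (g : LorentzMetric M) {n : ℕ} {x : M}
    {p f : Fin n → TangentSpace (𝓡 4) x} {δ : Fin n → ℝ} {P : Matrix (Fin n) (Fin n) ℝ}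
    {A : TangentSpace (𝓡 4) x → TangentSpace (𝓡 4) x → ℝ} (hδ : ∀ a, δ a * δ a = 1)
    (hf : ∀ a b, g.inner x (f a) (f b) = if a = b then δ a else 0)
    (hp : ∀ i, p i = ∑ a, P i a • f a) (hli : LinearIndependent ℝ p)
    (hA : ∀ i j, A (p i) (p j) = ∑ a, ∑ b, P i a * P j b * A (f a) (f b)) :
    g.metricTrace p A = ∑ a, δ a * A (f a) (f a) := by
  -- A linear relation between the rows of `P` would be the same relation between the `p i`.
  have hP : IsUnit P := by
    rw [← Matrix.linearIndependent_rows_iff_isUnit, Fintype.linearIndependent_iff]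
    intro c hc
    refine Fintype.linearIndependent_iff.1 hli c ?_
    simp only [hp, Finset.smul_sum, smul_smul]
    rw [Finset.sum_comm]
    refine Finset.sum_eq_zero fun a _ ↦ ?_
    rw [← Finset.sum_smul]
    have := congrFun hc a
    simp only [Finset.sum_apply, Pi.smul_apply, smul_eq_mul, Pi.zero_apply, Matrix.row] at this
    rw [this, zero_smul]
  have hPd : IsUnit P.det := (Matrix.isUnit_iff_isUnit_det _).1 hP
  have hPt : IsUnit P.transpose.det := by rwa [Matrix.det_transpose]
  have hD : (Matrix.diagonal δ) * Matrix.diagonal δ = 1 := by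
    rw [Matrix.diagonal_mul_diagonal, ← Matrix.diagonal_one]
    congr 1; ext a; exact hδ a
  set B : Matrix (Fin n) (Fin n) ℝ := Matrix.of fun a b ↦ A (f a) (f b) with hB
  -- With `D = diagonal δ`, its own inverse, the Gram matrix is `P D Pᵀ` and the matrix of `A` is `P
  -- B Pᵀ`; cyclicity of the trace then removes `P` and leaves `tr (D B)`.
  have hG : (Matrix.of fun i j ↦ g.inner x (p i) (p j)) = P * Matrix.diagonal δ * P.transpose := by
    ext i j
    simp [hp, Matrix.mul_apply, hf, Matrix.diagonal_apply]
    refine Finset.sum_congr rfl fun a _ ↦ ?_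
    ring
  have hGi : (P * Matrix.diagonal δ * P.transpose)⁻¹
      = P.transpose⁻¹ * Matrix.diagonal δ * P⁻¹ := by
    rw [Matrix.mul_inv_rev, Matrix.mul_inv_rev, Matrix.inv_eq_left_inv hD, Matrix.mul_assoc]
  have hAm : (Matrix.of fun i j ↦ A (p i) (p j)) = P * B * P.transpose := by
    ext i j
    simp [hA, Matrix.mul_apply, hB, Finset.sum_mul]
    rw [Finset.sum_comm]
    refine Finset.sum_congr rfl fun a _ ↦ Finset.sum_congr rfl fun b _ ↦ ?_
    ring
  have h1 : g.metricTrace p A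
      = ((P * Matrix.diagonal δ * P.transpose)⁻¹.transpose * (P * B * P.transpose)).trace := by
    rw [← hG, ← hAm]
    simp only [metricTrace, Matrix.trace, Matrix.mul_apply, Matrix.diag, Matrix.transpose_apply,
      Matrix.of_apply]
    rw [Finset.sum_comm]
  rw [h1, hGi]
  simp only [Matrix.transpose_mul, Matrix.diagonal_transpose, Matrix.transpose_nonsing_inv,
    Matrix.transpose_transpose]
  calc (P.transpose⁻¹ * (Matrix.diagonal δ * P⁻¹) * (P * B * P.transpose)).trace
      = (P.transpose⁻¹ * Matrix.diagonal δ * (P⁻¹ * P) * B * P.transpose).trace := by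
        simp only [Matrix.mul_assoc]
    _ = (P.transpose * P.transpose⁻¹ * Matrix.diagonal δ * B).trace := by
        rw [Matrix.nonsing_inv_mul _ hPd, Matrix.mul_one, Matrix.trace_mul_comm]
        simp only [Matrix.mul_assoc]
    _ = ∑ a, δ a * A (f a) (f a) := by
        rw [Matrix.mul_nonsing_inv _ hPt, Matrix.one_mul]
        simp [Matrix.trace, Matrix.diagonal_mul, hB]

/-- A smooth orthonormal frame of the tangent bundle, with `ε a = ±1` the squared length of the
vector field `b a`. -/
structure TangentFrame (g : LorentzMetric M) where
  b : Fin 4 → VField M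
  ε : Fin 4 → ℝ
  smooth (a : Fin 4) : (b a).Smooth
  sq (a : Fin 4) : ε a * ε a = 1
  orth (a c : Fin 4) (x : M) : g.pair (b a) (b c) x = if a = c then ε a else 0

variable {g : LorentzMetric M}

namespace TangentFrame

variable (B : g.TangentFrame)

theorem smoothAt (a : Fin 4) (x : M) : (B.b a).SmoothAt x := B.smooth a x

theorem inner_b (a c : Fin 4) (x : M) :
    g.inner x (B.b a x) (B.b c x) = if a = c then B.ε a else 0 := B.orth a c x

theorem ε_ne_zero (a : Fin 4) : B.ε a ≠ 0 := fun h ↦ by simpa [h] using B.sq a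

theorem linearIndependent (x : M) : LinearIndependent ℝ (fun a ↦ B.b a x) := by
  rw [Fintype.linearIndependent_iff]
  intro c hc a
  have h : g.inner x (∑ i, c i • B.b i x) (B.b a x) = 0 := by rw [hc]; simp
  simp only [map_sum, map_smul, sum_apply, smul_apply, B.inner_b] at h
  simpa [B.ε_ne_zero] using h

/-- The component of `v` along `b a`. -/
def coeff (a : Fin 4) {x : M} (v : TangentSpace (𝓡 4) x) : ℝ := B.ε a * g.inner x v (B.b a x)

/-- Four independent vectors span the tangent space. The difference of the two sides is orthogonal
to each of them, hence zero by nondegeneracy. -/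
theorem expand {x : M} (v : TangentSpace (𝓡 4) x) : v = ∑ a, B.coeff a v • B.b a x := by
  refine sub_eq_zero.1 (g.eq_zero_of_inner_eq_zero fun w ↦ ?_)
  have hs : Submodule.span ℝ (Set.range fun a ↦ B.b a x) = ⊤ :=
    (B.linearIndependent x).span_eq_top_of_card_eq_finrank'
      (by simp only [Fintype.card_fin]; exact (finrank_euclideanSpace_fin (𝕜 := ℝ) (n := 4)).symm)
  have hw : w ∈ Submodule.span ℝ (Set.range fun a ↦ B.b a x) := hs ▸ Submodule.mem_top
  induction hw using Submodule.span_induction with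
  | mem w hw =>
    obtain ⟨c, rfl⟩ := hw
    simp [coeff, B.inner_b, mul_right_comm, B.sq]
  | zero => simp
  | add v w _ _ hv hw => rw [map_add, hv, hw, add_zero]
  | smul c w _ hw => rw [map_smul, hw, smul_zero]

theorem coeff_b (a c : Fin 4) (x : M) : B.coeff a (B.b c x) = if c = a then 1 else 0 := by
  rw [coeff, B.inner_b]
  split_ifs with h
  · rw [h, B.sq]
  · simp

theorem inner_eq {x : M} (v w : TangentSpace (𝓡 4) x) :
    g.inner x v w = ∑ a, B.ε a * (g.inner x v (B.b a x) * g.inner x w (B.b a x)) := by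
  conv_lhs => rw [B.expand w]
  simp only [map_sum, map_smul, coeff, smul_eq_mul]
  exact Finset.sum_congr rfl fun a _ ↦ by ring

theorem field_expand (X : VField M) :
    X = fun y ↦ ∑ a, ((fun y ↦ B.coeff a (X y)) • B.b a) y := by
  ext1 y; exact B.expand (X y)

theorem smoothFunAt_coeff (a : Fin 4) {X : VField M} {x : M} (hX : X.SmoothAt x) :
    SmoothFunAt (fun y ↦ B.coeff a (X y)) x :=
  (SmoothFunAt.const (B.ε a) x).mul (g.smoothFunAt_pair hX (B.smoothAt a x))

/-- Serves for `∇_X Y` and gradients, which are known only through their inner products. -/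
theorem smoothAt_of_inner {X : VField M} {x : M}
    (h : ∀ a, SmoothFunAt (g.pair X (B.b a)) x) : X.SmoothAt x := by
  rw [B.field_expand X]
  exact VField.SmoothAt.sum fun a _ ↦
    (B.smoothAt a x).smul ((SmoothFunAt.const (B.ε a) x).mul (h a))

theorem deriv_bracket (B : g.TangentFrame) {X Y : VField M} {f : M → ℝ} {x : M} (hX : X.SmoothAt x)
    (hY : Y.SmoothAt x) (hf : SmoothFunAt f x) :
    (X.bracket Y).deriv f x = X.deriv (Y.deriv f) x - Y.deriv (X.deriv f) x :=
  VField.deriv_bracket hX hY (B.smoothAt 0 x) ((B.linearIndependent x).ne_zero 0) hf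

/-- A map that is additive and linear over functions is determined by its values on the frame. This
is what makes the curvature computable from components. -/
theorem eq_sum_of_tensorial {W : Type*} [AddCommGroup W] [Module ℝ W] {x : M} {Φ : VField M → W}
    (hadd : ∀ X Y, X.SmoothAt x → Y.SmoothAt x → Φ (X + Y) = Φ X + Φ Y)
    (hsmul : ∀ (f : M → ℝ) X, SmoothFunAt f x → X.SmoothAt x → Φ (f • X) = f x • Φ X)
    {X : VField M} (hX : X.SmoothAt x) : Φ X = ∑ a, B.coeff a (X x) • Φ (B.b a) := by
  have h0 : Φ (fun _ ↦ 0) = 0 := by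
    have := hsmul (fun _ ↦ 0) (B.b 0) (SmoothFunAt.const 0 x) (B.smoothAt 0 x)
    simp only [zero_smul] at this
    rw [← this]; congr 1; ext1 y; simp
  have key : ∀ s : Finset (Fin 4),
      Φ (fun y ↦ ∑ a ∈ s, ((fun y ↦ B.coeff a (X y)) • B.b a) y)
        = ∑ a ∈ s, B.coeff a (X x) • Φ (B.b a) := by
    intro s
    induction s using Finset.induction_on with
    | empty => simpa using h0
    | insert a s ha ih =>
      simp only [Finset.sum_insert ha]
      rw [← ih, ← hsmul _ _ (B.smoothFunAt_coeff a hX) (B.smoothAt a x)]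
      exact hadd _ _ ((B.smoothAt a x).smul (B.smoothFunAt_coeff a hX))
        (VField.SmoothAt.sum fun c _ ↦ (B.smoothAt c x).smul (B.smoothFunAt_coeff c hX))
  conv_lhs => rw [B.field_expand X]
  exact key Finset.univ

/-- The trace of a bilinear form in an orthonormal frame. -/
theorem trace_eq_sum {x : M} {A : TangentSpace (𝓡 4) x → TangentSpace (𝓡 4) x → ℝ}
    (hA : ∀ v w, A v w = ∑ a, ∑ c, B.coeff a v * B.coeff c w * A (B.b a x) (B.b c x)) :
    g.trace x A = ∑ a, B.ε a * A (B.b a x) (B.b a x) := by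
  refine g.metricTrace_eq_sum (f := fun a ↦ B.b a x) (P := fun i a ↦ B.coeff a (stdBasis x i))
    B.sq (fun a c ↦ B.inner_b a c x) (fun i ↦ B.expand _) ?_ (fun i j ↦ hA _ _)
  exact (EuclideanSpace.basisFun (Fin 4) ℝ).toBasis.linearIndependent

end TangentFrame

section Nabla

variable {X Y Z : VField M} {x : M} {f : M → ℝ}

theorem nabla_add_left (X X' Y : VField M) : g.nabla (X + X') Y = g.nabla X Y + g.nabla X' Y := by
  ext1 y; exact map_add _ _ _

theorem nabla_smul_left (f : M → ℝ) (X Y : VField M) : g.nabla (f • X) Y = f • g.nabla X Y := by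
  ext1 y; exact (g.leviCivita Y y).map_smul (f y) (X y)

theorem nabla_add_right (hY : Y.DiffAt x) (hZ : Z.DiffAt x) :
    g.nabla X (Y + Z) x = g.nabla X Y x + g.nabla X Z x := by
  have := g.leviCivita.isCovariantDerivativeOnUniv.add hY hZ
  exact congrArg (fun l ↦ l (X x)) this

theorem nabla_smul_right (hf : MDifferentiableAt (𝓡 4) 𝓘(ℝ) f x) (hY : Y.DiffAt x) :
    g.nabla X (f • Y) x = f x • g.nabla X Y x + X.deriv f x • Y x := by
  have := g.leviCivita.isCovariantDerivativeOnUniv.leibniz hY hf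
  exact congrArg (fun l ↦ l (X x)) this

theorem nabla_congr (hY : Y.SmoothAt x) (h : ∀ᶠ y in nhds x, Z y = Y y) :
    g.nabla X Z x = g.nabla X Y x := by
  have := g.leviCivita.isCovariantDerivativeOnUniv.congr_of_eventuallyEq (hY.congr h).diffAt
    hY.diffAt Filter.univ_mem h
  exact congrArg (fun l ↦ l (X x)) this

theorem smoothFunAt_koszul (hX : X.SmoothAt x) (hY : Y.SmoothAt x) (hZ : Z.SmoothAt x) :
    SmoothFunAt (g.koszul X Y Z) x := by
  have h : ∀ {X Y Z : VField M}, X.SmoothAt x → Y.SmoothAt x → Z.SmoothAt x →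
      SmoothFunAt (X.deriv (g.pair Y Z)) x := fun hX hY hZ ↦ hX.deriv (g.smoothFunAt_pair hY hZ)
  have h' : ∀ {X Y Z : VField M}, X.SmoothAt x → Y.SmoothAt x → Z.SmoothAt x →
      SmoothFunAt (g.pair (X.bracket Y) Z) x :=
    fun hX hY hZ ↦ g.smoothFunAt_pair (hX.bracket hY) hZ
  exact (((((h hX hY hZ).add (h hY hX hZ)).sub (h hZ hX hY)).add (h' hX hY hZ)).sub
    (h' hX hZ hY)).sub (h' hY hZ hX)

/-- Near `x` the frame components are half the Koszul expression, which is smooth. -/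
theorem TangentFrame.smoothAt_nabla (B : g.TangentFrame) (hX : X.SmoothAt x) (hY : Y.SmoothAt x) :
    (g.nabla X Y).SmoothAt x := by
  refine B.smoothAt_of_inner fun a ↦ ?_
  have h := (SmoothFunAt.const (1 / 2) x).mul (smoothFunAt_koszul (g := g) hX hY (B.smoothAt a x))
  refine ContMDiffAt.congr_of_eventuallyEq h ?_
  filter_upwards [hX.eventually_diffAt, hY.eventually_diffAt] with y h1 h2
  have := g.two_inner_covAt h1 h2 (B.smoothAt a y).diffAt
  simp only [Pi.mul_apply, ← this, pair, nabla, leviCivita]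
  ring

end Nabla

end LorentzMetric

end Frame

/-! ### Tensoriality, components and symmetries of the curvature. -/

section Curvature

variable {M : Type*} [TopologicalSpace M] [ChartedSpace E4 M] [IsManifold (𝓡 4) ∞ M]

namespace LorentzMetric

variable {g : LorentzMetric M} {X X' Y Y' Z Z' : VField M} {x : M} {f : M → ℝ}

theorem bracket_swap (X Y : VField M) : X.bracket Y = -Y.bracket X := mlieBracket_swap

theorem nabla_neg_left (X Y : VField M) : g.nabla (-X) Y x = -g.nabla X Y x :=
  map_neg (g.leviCivita Y x) (X x)

theorem riemann_swap (X Y Z : VField M) : g.riemann X Y Z x = -g.riemann Y X Z x := by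
  unfold riemann
  rw [bracket_swap X Y, nabla_neg_left]
  abel

namespace TangentFrame

variable (B : g.TangentFrame)

theorem riemann_add_left (B : g.TangentFrame) (hX : X.SmoothAt x) (hX' : X'.SmoothAt x)
    (hZ : Z.SmoothAt x) :
    g.riemann (X + X') Y Z x = g.riemann X Y Z x + g.riemann X' Y Z x := by
  have hb : (X + X').bracket Y x = X.bracket Y x + X'.bracket Y x :=
    mlieBracket_add_left hX.diffAt hX'.diffAt
  have h1 : g.nabla ((X + X').bracket Y) Z x
      = g.nabla (X.bracket Y) Z x + g.nabla (X'.bracket Y) Z x := by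
    rw [nabla, hb, map_add]; rfl
  unfold riemann
  rw [nabla_add_left, nabla_add_left, h1, nabla_add_right (B.smoothAt_nabla hX hZ).diffAt
    (B.smoothAt_nabla hX' hZ).diffAt, Pi.add_apply]
  abel

/-- The term `(Y f) ∇_X Z` from `∇_Y (f ∇_X Z)` cancels the one from `[f X, Y] = f [X, Y] - (Y f)
X`. -/
theorem riemann_smul_left (B : g.TangentFrame) (hf : SmoothFunAt f x) (hX : X.SmoothAt x)
    (hZ : Z.SmoothAt x) : g.riemann (f • X) Y Z x = f x • g.riemann X Y Z x := by
  have hb : (f • X).bracket Y x = -Y.deriv f x • X x + f x • X.bracket Y x :=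
    mlieBracket_smul_left hf.mdiff hX.diffAt
  have h1 : g.nabla ((f • X).bracket Y) Z x
      = -Y.deriv f x • g.nabla X Z x + f x • g.nabla (X.bracket Y) Z x := by
    rw [nabla, hb, map_add, map_smul, map_smul]; rfl
  unfold riemann
  rw [nabla_smul_left, nabla_smul_left, h1,
    nabla_smul_right hf.mdiff (B.smoothAt_nabla hX hZ).diffAt, Pi.smul_apply']
  module

theorem riemann_add_right (B : g.TangentFrame) (hX : X.SmoothAt x) (hY : Y.SmoothAt x) (hZ : Z.SmoothAt x)
    (hZ' : Z'.SmoothAt x) :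
    g.riemann X Y (Z + Z') x = g.riemann X Y Z x + g.riemann X Y Z' x := by
  have key : ∀ {X Y : VField M}, X.SmoothAt x → Y.SmoothAt x →
      g.nabla X (g.nabla Y (Z + Z')) x
        = g.nabla X (g.nabla Y Z) x + g.nabla X (g.nabla Y Z') x := by
    intro X Y hX hY
    rw [← nabla_add_right (B.smoothAt_nabla hY hZ).diffAt (B.smoothAt_nabla hY hZ').diffAt]
    refine nabla_congr ((B.smoothAt_nabla hY hZ).add (B.smoothAt_nabla hY hZ')) ?_
    filter_upwards [hZ.eventually_diffAt, hZ'.eventually_diffAt] with y h1 h2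
    exact nabla_add_right h1 h2
  unfold riemann
  rw [key hX hY, key hY hX, nabla_add_right hZ.diffAt hZ'.diffAt]
  abel

/-- The mixed first-order terms are symmetric in `X, Y` and cancel; the second-order part `X Y f - Y
X f` cancels against `[X, Y] f`. -/
theorem riemann_smul_right (B : g.TangentFrame) (hf : SmoothFunAt f x) (hX : X.SmoothAt x) (hY : Y.SmoothAt x)
    (hZ : Z.SmoothAt x) : g.riemann X Y (f • Z) x = f x • g.riemann X Y Z x := by
  have key : ∀ {X Y : VField M}, X.SmoothAt x → Y.SmoothAt x →
      g.nabla X (g.nabla Y (f • Z)) x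
        = f x • g.nabla X (g.nabla Y Z) x + X.deriv f x • g.nabla Y Z x
          + (Y.deriv f x • g.nabla X Z x + X.deriv (Y.deriv f) x • Z x) := by
    intro X Y hX hY
    rw [← nabla_smul_right hf.mdiff (B.smoothAt_nabla hY hZ).diffAt,
      ← nabla_smul_right (hY.deriv hf).mdiff hZ.diffAt,
      ← nabla_add_right ((B.smoothAt_nabla hY hZ).smul hf).diffAt (hZ.smul (hY.deriv hf)).diffAt]
    refine nabla_congr (((B.smoothAt_nabla hY hZ).smul hf).add (hZ.smul (hY.deriv hf))) ?_
    filter_upwards [hZ.eventually_diffAt, hf.eventually_mdiff] with y h1 h2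
    exact nabla_smul_right h2 h1
  unfold riemann
  rw [key hX hY, key hY hX, nabla_smul_right hf.mdiff hZ.diffAt, B.deriv_bracket hX hY hf]
  module

theorem riemann_left (hX : X.SmoothAt x) (hZ : Z.SmoothAt x) :
    g.riemann X Y Z x = ∑ a, B.coeff a (X x) • g.riemann (B.b a) Y Z x :=
  B.eq_sum_of_tensorial (Φ := fun X ↦ g.riemann X Y Z x)
    (fun _ _ h h' ↦ B.riemann_add_left h h' hZ)
    (fun _ _ hf h ↦ B.riemann_smul_left hf h hZ) hX

theorem riemann_mid (hY : Y.SmoothAt x) (hZ : Z.SmoothAt x) :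
    g.riemann X Y Z x = ∑ a, B.coeff a (Y x) • g.riemann X (B.b a) Z x := by
  rw [riemann_swap, B.riemann_left hY hZ, ← Finset.sum_neg_distrib]
  refine Finset.sum_congr rfl fun a _ ↦ ?_
  rw [riemann_swap X, smul_neg]

theorem riemann_right (hX : X.SmoothAt x) (hY : Y.SmoothAt x) (hZ : Z.SmoothAt x) :
    g.riemann X Y Z x = ∑ a, B.coeff a (Z x) • g.riemann X Y (B.b a) x :=
  B.eq_sum_of_tensorial (Φ := fun Z ↦ g.riemann X Y Z x)
    (fun _ _ h h' ↦ B.riemann_add_right hX hY h h')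
    (fun _ _ hf h ↦ B.riemann_smul_right hf hX hY h) hZ

/-- The components `g(R(b_a, b_c) b_d, b_f)` of the curvature. -/
def riem (a c d f : Fin 4) (x : M) : ℝ :=
  g.pair (g.riemann (B.b a) (B.b c) (B.b d)) (B.b f) x

/-- The components of the Ricci tensor. -/
def ric (a c : Fin 4) (x : M) : ℝ := ∑ d, B.ε d * B.riem d a c d x

/-- Tensoriality in each slot replaces the local extensions in the definition by the global frame.
-/
theorem ricci_eq (u v : TangentSpace (𝓡 4) x) :
    g.ricci x u v = ∑ a, ∑ c, B.coeff a u * B.coeff c v * B.ric a c x := by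
  have h1 : ∀ z w : TangentSpace (𝓡 4) x,
      g.inner x (g.riemann (.ext z) (.ext u) (.ext v) x) w
        = ∑ d, ∑ a, ∑ c, ∑ f, B.coeff d z * (B.coeff a u * (B.coeff c v
          * (B.coeff f w * B.riem d a c f x))) := by
    intro z w
    have hs := @VField.smoothAt_ext M _ _ _ x
    rw [B.riemann_left (hs z) (hs v)]
    conv_lhs => rw [B.expand w]
    simp only [map_sum, sum_apply, map_smul, smul_apply, smul_eq_mul, extend_apply_self,
      Finset.mul_sum]
    rw [Finset.sum_comm]
    refine Finset.sum_congr rfl fun d _ ↦ ?_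
    rw [B.riemann_mid (hs u) (hs v)]
    simp only [map_sum, sum_apply, map_smul, smul_apply, smul_eq_mul, extend_apply_self,
      Finset.mul_sum]
    rw [Finset.sum_comm]
    refine Finset.sum_congr rfl fun a _ ↦ ?_
    rw [B.riemann_right (B.smoothAt d x) (B.smoothAt a x) (hs v)]
    simp only [map_sum, sum_apply, map_smul, smul_apply, smul_eq_mul, extend_apply_self,
      Finset.mul_sum]
    rw [Finset.sum_comm]
    refine Finset.sum_congr rfl fun c _ ↦ Finset.sum_congr rfl fun f _ ↦ ?_
    simp only [riem, pair]
    ring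
  have h2 : ∀ d f, g.inner x (g.riemann (.ext (B.b d x)) (.ext u) (.ext v) x) (B.b f x)
      = ∑ a, ∑ c, B.coeff a u * (B.coeff c v * B.riem d a c f x) := by
    intro d f
    rw [h1]
    simp [B.coeff_b, Finset.sum_ite_eq]
  unfold ricci
  rw [B.trace_eq_sum]
  · simp only [h2, ric, Finset.mul_sum]
    rw [Finset.sum_comm]
    refine Finset.sum_congr rfl fun a _ ↦ ?_
    rw [Finset.sum_comm]
    refine Finset.sum_congr rfl fun c _ ↦ Finset.sum_congr rfl fun d _ ↦ ?_
    ring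
  · intro z w
    rw [h1]
    simp only [h2, Finset.mul_sum]
    refine Finset.sum_congr rfl fun d _ ↦ ?_
    refine ((Finset.sum_congr rfl fun a _ ↦ Finset.sum_comm).trans Finset.sum_comm).trans ?_
    refine Finset.sum_congr rfl fun f _ ↦ Finset.sum_congr rfl fun a _ ↦
      Finset.sum_congr rfl fun c _ ↦ ?_
    ring

theorem ricci_b (a c : Fin 4) : g.ricci x (B.b a x) (B.b c x) = B.ric a c x := by
  rw [B.ricci_eq]
  simp [B.coeff_b]

/-- The connection coefficients `g(∇_{b_a} b_c, b_d)`. -/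
def conn (a c d : Fin 4) : M → ℝ := g.pair (g.nabla (B.b a) (B.b c)) (B.b d)

theorem smoothAt_nabla_b (a c : Fin 4) (x : M) : (g.nabla (B.b a) (B.b c)).SmoothAt x :=
  B.smoothAt_nabla (B.smoothAt a x) (B.smoothAt c x)

theorem smooth_conn (a c d : Fin 4) (x : M) : SmoothFunAt (B.conn a c d) x :=
  g.smoothFunAt_pair (B.smoothAt_nabla_b a c x) (B.smoothAt d x)

/-- Metric compatibility applied to the constant function `g(b_c, b_d)`. -/
theorem conn_swap (a c d : Fin 4) (x : M) : B.conn a c d x = -B.conn a d c x := by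
  have h := g.deriv_pair (B.smoothAt a x).diffAt (B.smoothAt c x).diffAt (B.smoothAt d x).diffAt
  have h0 : g.pair (B.b c) (B.b d) = fun _ ↦ if c = d then B.ε c else 0 := by
    ext1 y; exact B.orth c d y
  rw [h0, VField.deriv_const, g.pair_comm (B.b c)] at h
  simp only [conn]
  linarith

theorem inner_nabla (X : VField M) (a c : Fin 4) :
    g.inner x (X x) (g.nabla (B.b a) (B.b c) x)
      = ∑ d, B.ε d * (g.pair X (B.b d) x * B.conn a c d x) := by
  rw [B.inner_eq]; rfl

theorem pair_nabla_left (Y : VField M) (d : Fin 4) (Z : VField M) :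
    g.pair (g.nabla Z Y) (B.b d) x
      = ∑ f, B.ε f * (g.pair Z (B.b f) x * g.pair (g.nabla (B.b f) Y) (B.b d) x) := by
  have : g.nabla Z Y x = ∑ f, B.coeff f (Z x) • g.nabla (B.b f) Y x := by
    conv_lhs => rw [nabla, B.expand (Z x), map_sum]
    simp only [map_smul]; rfl
  rw [pair, this]
  simp only [map_sum, sum_apply, map_smul, smul_apply, smul_eq_mul, coeff, pair]
  exact Finset.sum_congr rfl fun f _ ↦ by ring

theorem bracket_b (a c d : Fin 4) :
    g.pair ((B.b a).bracket (B.b c)) (B.b d) x = B.conn a c d x - B.conn c a d x := by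
  have := g.nabla_sub_nabla (B.smoothAt a x).diffAt (B.smoothAt c x).diffAt
  simp only [pair, ← this, conn]
  simp

/-- The curvature in terms of the connection coefficients. -/
theorem riem_eq (a c d f : Fin 4) (x : M) :
    B.riem a c d f x = (B.b a).deriv (B.conn c d f) x - (B.b c).deriv (B.conn a d f) x
      - ∑ l, B.ε l * (B.conn c d l x * B.conn a f l x)
      + ∑ l, B.ε l * (B.conn a d l x * B.conn c f l x)
      - ∑ l, B.ε l * ((B.conn a c l x - B.conn c a l x) * B.conn l d f x) := by
  -- Metric compatibility moves the outer derivative off: `g(∇_a ∇_c b_d, b_f) = b_a g(∇_c b_d, b_f)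
  -- - g(∇_c b_d, ∇_a b_f)`.
  have key : ∀ a c, g.pair (g.nabla (B.b a) (g.nabla (B.b c) (B.b d))) (B.b f) x
      = (B.b a).deriv (B.conn c d f) x - ∑ l, B.ε l * (B.conn c d l x * B.conn a f l x) := by
    intro a c
    have h := g.deriv_pair (B.smoothAt a x).diffAt (B.smoothAt_nabla_b c d x).diffAt
      (B.smoothAt f x).diffAt
    have h2 := B.inner_nabla (x := x) (g.nabla (B.b c) (B.b d)) a f
    simp only [conn, pair] at h h2 ⊢
    linarith
  have h3 := B.pair_nabla_left (x := x) (B.b d) f ((B.b a).bracket (B.b c))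
  simp only [B.bracket_b] at h3
  have h1 := key a c
  have h2 := key c a
  simp only [riem, pair, riemann, map_sub, sub_apply] at h1 h2 h3 ⊢
  rw [h1, h2, h3]
  simp only [conn, pair]
  ring

theorem riem_swap_left (a c d f : Fin 4) (x : M) : B.riem a c d f x = -B.riem c a d f x := by
  simp only [riem, pair]
  rw [riemann_swap]; simp

theorem riem_swap_right (a c d f : Fin 4) (x : M) : B.riem a c d f x = -B.riem a c f d x := by
  have h : ∀ a, B.conn a f d = fun y ↦ -B.conn a d f y := fun a ↦ by
    ext1 y; exact B.conn_swap a f d y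
  rw [B.riem_eq, B.riem_eq, h, h, VField.deriv_neg, VField.deriv_neg]
  have : ∀ l, B.ε l * ((B.conn a c l x - B.conn c a l x) * -B.conn l d f x)
      = -(B.ε l * ((B.conn a c l x - B.conn c a l x) * B.conn l d f x)) := fun l ↦ by ring
  simp only [h, this, Finset.sum_neg_distrib, mul_comm (B.conn c f _ x),
    mul_comm (B.conn a f _ x)]
  ring

/-- Vanishing torsion turns the cyclic sum into a cyclic sum of double brackets, which vanishes by
Jacobi. -/
theorem bianchi (a c d f : Fin 4) (x : M) :
    B.riem a c d f x + B.riem c d a f x + B.riem d a c f x = 0 := by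
  have key : ∀ a c d, g.nabla (B.b a) (g.nabla (B.b c) (B.b d)) x
      - g.nabla (B.b a) (g.nabla (B.b d) (B.b c)) x
      - g.nabla ((B.b c).bracket (B.b d)) (B.b a) x
      = (B.b a).bracket ((B.b c).bracket (B.b d)) x := by
    intro a c d
    have hb := (B.smoothAt c x).bracket (B.smoothAt d x)
    rw [← g.nabla_sub_nabla (B.smoothAt a x).diffAt hb.diffAt]
    have : g.nabla (B.b c) (B.b d) = g.nabla (B.b d) (B.b c) + (B.b c).bracket (B.b d) := by
      ext1 y
      have := g.nabla_sub_nabla (B.smoothAt c y).diffAt (B.smoothAt d y).diffAt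
      rw [Pi.add_apply, ← this]; abel
    rw [this, nabla_add_right (B.smoothAt_nabla_b d c x).diffAt hb.diffAt]
    abel
  have hj := VField.jacobi (B.smoothAt a x) (B.smoothAt c x) (B.smoothAt d x)
  have e1 : ((B.b a).bracket (B.b c)).bracket (B.b d) x
      = -(B.b d).bracket ((B.b a).bracket (B.b c)) x := mlieBracket_swap_apply
  have e2 : (B.b c).bracket ((B.b a).bracket (B.b d)) x
      = -(B.b c).bracket ((B.b d).bracket (B.b a)) x := by
    -- The sign inside the bracket is pulled out as multiplication by the constant function `-1`.
    have h0 := VField.bracket_smul_right (X := B.b c) (SmoothFunAt.const (-1) x)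
      ((B.smoothAt d x).bracket (B.smoothAt a x))
    have h00 : (fun _ : M ↦ (-1 : ℝ)) • (B.b d).bracket (B.b a) = (B.b a).bracket (B.b d) := by
      rw [bracket_swap (B.b a)]; ext1 y; simp
    rw [h00, VField.deriv_const] at h0
    rw [h0]
    simp
  rw [e1, e2, ← key, ← key, ← key] at hj
  have : g.riemann (B.b a) (B.b c) (B.b d) x + g.riemann (B.b c) (B.b d) (B.b a) x
      + g.riemann (B.b d) (B.b a) (B.b c) x = 0 := by
    unfold riemann
    rw [← sub_eq_zero] at hj
    rw [← hj]
    abel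
  have h2 := congrArg (fun v ↦ g.inner x v (B.b f x)) this
  simpa [riem, pair] using! h2

/-- The pair symmetry of the curvature. -/
theorem riem_pair_symm (a c d f : Fin 4) (x : M) : B.riem a c d f x = B.riem d f a c x := by
  have s1 := B.riem_swap_left
  have s2 := B.riem_swap_right
  -- Four cyclic Bianchi identities, one for each index omitted from the cycle, combine linearly
  -- with the antisymmetries.
  linarith [B.bianchi a c d f x, B.bianchi c d f a x, B.bianchi d f a c x, B.bianchi f a c d x,
    s1 a c d f x, s1 c d a f x, s1 d a c f x, s1 c d f a x, s1 d f c a x, s1 f c d a x,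
    s1 d f a c x, s1 f a d c x, s1 a d f c x, s1 f a c d x, s1 a c f d x, s1 c f a d x,
    s2 a c d f x, s2 c d a f x, s2 d a c f x, s2 c d f a x, s2 d f c a x, s2 f c d a x,
    s2 d f a c x, s2 f a d c x, s2 a d f c x, s2 f a c d x, s2 a c f d x, s2 c f a d x]

theorem ric_symm (a c : Fin 4) (x : M) : B.ric a c x = B.ric c a x := by
  unfold ric
  refine Finset.sum_congr rfl fun d _ ↦ ?_
  rw [B.riem_pair_symm, B.riem_swap_left, B.riem_swap_right, neg_neg]

end TangentFrame

end LorentzMetric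

end Curvature

/-! ### Wave operator and Einstein equations in frame components. -/

section FieldEquations

variable {M : Type*} [TopologicalSpace M] [ChartedSpace E4 M] [IsManifold (𝓡 4) ∞ M]

namespace LorentzMetric

variable {g : LorentzMetric M} {x : M} {f : M → ℝ}

theorem pair_grad (f : M → ℝ) (X : VField M) : g.pair (g.grad f) X = X.deriv f := by
  ext1 y; exact g.inner_sharp y _ _

namespace TangentFrame

variable (B : g.TangentFrame)

theorem smoothAt_grad (B : g.TangentFrame) (hf : SmoothFunAt f x) : (g.grad f).SmoothAt x := by
  refine B.smoothAt_of_inner fun a ↦ ?_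
  rw [pair_grad]
  exact (B.smoothAt a x).deriv hf

/-- Since `g(grad f, b_a) = b_a f`, compatibility gives `Hess f(b_a, b_a) = b_a b_a f - (∇_{b_a}
b_a) f`. -/
theorem box_eq (hf : SmoothFunAt f x) :
    g.box f x = ∑ a, B.ε a * ((B.b a).deriv ((B.b a).deriv f) x
      - ∑ c, B.ε c * (B.conn a a c x * (B.b c).deriv f x)) := by
  unfold box
  rw [B.trace_eq_sum]
  · refine Finset.sum_congr rfl fun a _ ↦ ?_
    have h := g.deriv_pair (B.smoothAt a x).diffAt (B.smoothAt_grad hf).diffAt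
      (B.smoothAt a x).diffAt
    have h2 := B.inner_nabla (x := x) (g.grad f) a a
    rw [pair_grad] at h
    simp only [pair_grad] at h2
    have h3 : ∀ c, B.conn a a c x * (B.b c).deriv f x = (B.b c).deriv f x * B.conn a a c x :=
      fun c ↦ mul_comm _ _
    simp only [h3, ← h2, h, pair, nabla]
    ring
  · intro v w
    conv_lhs => rw [B.expand v, B.expand w]
    simp only [map_sum, sum_apply, map_smul, smul_apply, smul_eq_mul, Finset.mul_sum]
    rw [Finset.sum_comm]
    exact Finset.sum_congr rfl fun a _ ↦ Finset.sum_congr rfl fun c _ ↦ by ring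

theorem scalarCurvature_eq : g.scalarCurvature x = ∑ a, B.ε a * B.ric a a x := by
  unfold scalarCurvature
  rw [B.trace_eq_sum]
  · simp only [B.ricci_b]
  · intro v w
    rw [B.ricci_eq]
    simp only [B.ricci_b]

theorem inner_grad_grad (f : M → ℝ) :
    g.inner x (g.grad f x) (g.grad f x) = ∑ a, B.ε a * (B.b a).deriv f x ^ 2 := by
  rw [B.inner_eq]
  refine Finset.sum_congr rfl fun a _ ↦ ?_
  have : g.inner x (g.grad f x) (B.b a x) = (B.b a).deriv f x := congrFun (pair_grad f (B.b a)) x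
  rw [this]; ring

/-- The Einstein equations of a scalar field in trace reversed form. -/
theorem einstein_iff (V : ℝ → ℝ) (φ : M → ℝ) :
    (∀ u v : TangentSpace (𝓡 4) x, g.ricci x u v - 1 / 2 * g.scalarCurvature x * g.inner x u v
      = g.energyMomentum V φ x u v) ↔
    ∀ a c, B.ric a c x = (B.b a).deriv φ x * (B.b c).deriv φ x
      + V (φ x) * (if a = c then B.ε a else 0) := by
  set q := g.inner x (g.grad φ x) (g.grad φ x) with hq
  have hq' := B.inner_grad_grad (x := x) φ
  have hS := B.scalarCurvature_eq (x := x)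
  have sq := B.sq
  constructor
  · intro h
    have h1 : ∀ a c, B.ric a c x - 1 / 2 * g.scalarCurvature x * (if a = c then B.ε a else 0)
        = (B.b a).deriv φ x * (B.b c).deriv φ x
          - (1 / 2 * q + V (φ x)) * (if a = c then B.ε a else 0) := by
      intro a c
      have := h (B.b a x) (B.b c x)
      rwa [B.ricci_b, B.inner_b, energyMomentum, B.inner_b] at this
    have h2 : ∀ a, B.ε a * B.ric a a x = 1 / 2 * g.scalarCurvature x
        + B.ε a * (B.b a).deriv φ x ^ 2 - (1 / 2 * q + V (φ x)) := by
      intro a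
      have := h1 a a
      simp only [if_true] at this
      linear_combination B.ε a * this
        + (1 / 2 * g.scalarCurvature x - (1 / 2 * q + V (φ x))) * sq a
    -- The trace of the equation, where `tr g = 4`: `S - 2 S = q - 4 (q / 2 + V)`.
    have h3 : g.scalarCurvature x = q + 4 * V (φ x) := by
      simp only [h2, Fin.sum_univ_four] at hS
      rw [Fin.sum_univ_four] at hq'
      linarith
    intro a c
    have := h1 a c
    rw [h3] at this
    linear_combination this
  · intro h u v
    have h3 : g.scalarCurvature x = q + 4 * V (φ x) := by
      rw [hS, hq, hq']
      simp only [h, if_true, Fin.sum_univ_four]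
      linear_combination V (φ x) * (sq 0 + sq 1 + sq 2 + sq 3)
    have hd : ∀ v : TangentSpace (𝓡 4) x,
        mvfderiv (𝓡 4) φ x v = ∑ a, B.coeff a v * (B.b a).deriv φ x := by
      intro v
      conv_lhs => rw [B.expand v, map_sum]
      simp only [map_smul, smul_eq_mul]; rfl
    have hi : g.inner x u v = ∑ a, B.ε a * (B.coeff a u * B.coeff a v) := by
      rw [B.inner_eq]
      refine Finset.sum_congr rfl fun a _ ↦ ?_
      simp only [coeff]
      linear_combination (-B.ε a * (g.inner x u (B.b a x) * g.inner x v (B.b a x))) * sq a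
    have hr : g.ricci x u v = mvfderiv (𝓡 4) φ x u * mvfderiv (𝓡 4) φ x v
        + V (φ x) * g.inner x u v := by
      rw [B.ricci_eq, hd u, hd v, hi, Finset.sum_mul_sum]
      simp only [h, mul_add, Finset.sum_add_distrib, Finset.mul_sum]
      congr 1
      · exact Finset.sum_congr rfl fun a _ ↦ Finset.sum_congr rfl fun c _ ↦ by ring
      · refine Finset.sum_congr rfl fun a _ ↦ ?_
        simp only [mul_ite, mul_zero, Finset.sum_ite_eq, Finset.mem_univ, if_true]
        ring
    rw [hr, h3, energyMomentum]
    ring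

end TangentFrame

end LorentzMetric

end FieldEquations

/-! ### The frame adapted to the foliation and its connection coefficients. -/

section AdaptedFrame

variable {M : Type*} [TopologicalSpace M] [ChartedSpace E4 M]
  [IsManifold (𝓡 4) ∞ M] {g : LorentzMetric M} {F : ZeroShiftFoliation g} {x : M}

namespace ZeroShiftFoliation

theorem smoothAt_normal (F : ZeroShiftFoliation g) (x : M) : F.normal.SmoothAt x :=
  VField.SmoothAt.smul (F.partialT_smooth x)
    (SmoothFunAt.inv (F.N_smooth x) (F.N_pos x).ne')

theorem inner_normal (v : TangentSpace (𝓡 4) x) :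
    g.inner x (F.normal x) v = -F.N x * mvfderiv (𝓡 4) F.t x v := by
  have h := (F.N_pos x).ne'
  simp only [normal, map_smul, smul_apply, F.inner_partialT, smul_eq_mul]
  field_simp

theorem deriv_normal_eq (f : M → ℝ) : F.normal.deriv f x = (F.N x)⁻¹ * F.partialT.deriv f x := by
  simp [VField.deriv, normal]

theorem deriv_normal_t : F.normal.deriv F.t = fun x ↦ (F.N x)⁻¹ := by
  ext1 x; rw [deriv_normal_eq, F.deriv_partialT, mul_one]

theorem inner_normal_normal : g.inner x (F.normal x) (F.normal x) = -1 := by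
  have h := (F.N_pos x).ne'
  have h1 : mvfderiv (𝓡 4) F.t x (F.normal x) = (F.N x)⁻¹ := congrFun F.deriv_normal_t x
  rw [inner_normal, h1]
  field_simp

theorem deriv_lnN (X : VField M) : X.deriv F.lnN x = (F.N x)⁻¹ * X.deriv F.N x :=
  VField.deriv_comp (Real.hasDerivAt_log (F.N_pos x).ne') (F.N_smooth x)

end ZeroShiftFoliation

namespace OrthonormalFrame

variable (e : OrthonormalFrame F)

/-- The orthonormal frame `e_0, e_1, e_2, e_3`. -/
def frame : g.TangentFrame where
  b := Fin.cons F.normal e.e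
  ε := Fin.cons (-1) fun _ ↦ 1
  smooth a := by
    refine Fin.cases ?_ (fun I ↦ ?_) a
    · exact fun x ↦ F.smoothAt_normal x
    · exact e.smooth I
  sq a := by refine Fin.cases ?_ (fun I ↦ ?_) a <;> simp
  orth a c x := by
    have h0 : ∀ I, g.pair F.normal (e.e I) x = 0 := fun I ↦ by
      have := e.tangent I x
      rw [VField.deriv] at this
      rw [LorentzMetric.pair, F.inner_normal, this, mul_zero]
    refine Fin.cases ?_ (fun I ↦ ?_) a <;> refine Fin.cases ?_ (fun J ↦ ?_) c
    · simpa using! F.inner_normal_normal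
    · simpa [(Fin.succ_ne_zero J).symm] using h0 J
    · rw [g.pair_comm]
      simpa [Fin.succ_ne_zero I] using h0 I
    · simpa using e.orthonormal I J x

@[simp] theorem frame_b_zero : e.frame.b 0 = F.normal := rfl
@[simp] theorem frame_b_succ (I : Fin 3) : e.frame.b I.succ = e.e I := rfl
@[simp] theorem frame_ε_zero : e.frame.ε 0 = -1 := rfl
@[simp] theorem frame_ε_succ (I : Fin 3) : e.frame.ε I.succ = 1 := rfl

theorem smoothAt (I : Fin 3) (x : M) : (e.e I).SmoothAt x := e.smooth I x

theorem pair_normal (I : Fin 3) : g.inner x (F.normal x) (e.e I x) = 0 :=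
  e.frame.orth 0 I.succ x

/-- Because `g(e_0, ·) = -N dt`, the normal part of a bracket is read off from its action on `t`. -/
theorem pair_bracket_normal (e : OrthonormalFrame F) (X Y : VField M) (hX : X.SmoothAt x) (hY : Y.SmoothAt x) :
    g.pair (X.bracket Y) F.normal x
      = -F.N x * (X.deriv (Y.deriv F.t) x - Y.deriv (X.deriv F.t) x) := by
  have := e.frame.deriv_bracket hX hY (F.t_smooth x)
  rw [g.pair_comm, LorentzMetric.pair, F.inner_normal, ← this, VField.deriv]

theorem deriv_t (I : Fin 3) : (e.e I).deriv F.t = fun _ ↦ 0 := by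
  ext1 x; exact e.tangent I x

theorem conn_succ_zero_succ (I J : Fin 3) : e.frame.conn I.succ 0 J.succ = e.k I J := rfl

theorem conn_succ_succ_succ (I J K : Fin 3) :
    e.frame.conn I.succ J.succ K.succ = e.Γ I J K := rfl

theorem conn_self (a c : Fin 4) : e.frame.conn a c c = fun _ ↦ 0 := by
  ext1 x; linarith [e.frame.conn_swap a c c x]

theorem conn_succ_succ_zero (I J : Fin 3) :
    e.frame.conn I.succ J.succ 0 = fun x ↦ -e.k I J x := by
  ext1 x; rw [e.frame.conn_swap, conn_succ_zero_succ]

/-- Integrability of the leaves: `e_I t = e_J t = 0` forces `[e_I, e_J] t = 0`. -/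
theorem k_symm (I J : Fin 3) : e.k I J = e.k J I := by
  ext1 x
  have h1 := e.frame.bracket_b (x := x) I.succ J.succ 0
  have h2 := e.pair_bracket_normal _ _ (e.smoothAt I x) (e.smoothAt J x)
  rw [e.deriv_t, e.deriv_t, VField.deriv_const, VField.deriv_const] at h2
  rw [conn_succ_succ_zero, conn_succ_succ_zero] at h1
  simp only [frame_b_succ, frame_b_zero] at h1
  linarith

/-- As `g(∇_{e_I} e_0, e_0) = 0`, this is `g([e_0, e_I], e_0) = N e_I(N⁻¹)`. It holds for every
adapted frame. -/
theorem conn_zero_succ_zero (I : Fin 3) :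
    e.frame.conn 0 I.succ 0 = fun x ↦ -e.D I F.lnN x := by
  ext1 x
  have h1 := e.frame.bracket_b (x := x) 0 I.succ 0
  have h2 := e.pair_bracket_normal _ _ (F.smoothAt_normal x) (e.smoothAt I x)
  have hN := (F.N_pos x).ne'
  rw [e.deriv_t, F.deriv_normal_t, VField.deriv_const,
    VField.deriv_comp (F := fun r ↦ r⁻¹) (hasDerivAt_inv hN) (F.N_smooth x)] at h2
  rw [conn_self] at h1
  simp only [frame_b_succ, frame_b_zero] at h1
  rw [D, F.deriv_lnN]
  have : e.frame.conn 0 I.succ 0 x = -F.N x * (0 - -(F.N x ^ 2)⁻¹ * (e.e I).deriv F.N x) := by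
    linarith
  rw [this]
  field_simp
  ring

theorem conn_zero_zero_succ (I : Fin 3) : e.frame.conn 0 0 I.succ = e.D I F.lnN := by
  ext1 x; rw [e.frame.conn_swap, conn_zero_succ_zero, neg_neg]

theorem Γ_swap (I J K : Fin 3) (x : M) : e.Γ I J K x = -e.Γ I K J x := 
  e.frame.conn_swap I.succ J.succ K.succ x

theorem smoothFunAt_k (I J : Fin 3) (x : M) : SmoothFunAt (e.k I J) x :=
  e.frame.smooth_conn I.succ 0 J.succ x

/-- The rotation coefficients `g(∇_{e_0} e_I, e_J)`. -/
def rot (I J : Fin 3) : M → ℝ := e.frame.conn 0 I.succ J.succ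

/-- The `e_0` component of the transport equation is automatic by `conn_zero_succ_zero`, so only the
rotation is constrained. -/
theorem isFermiWalker_iff : e.IsFermiWalker ↔ ∀ I J x, e.rot I J x = 0 := by
  constructor
  · intro h I J x
    change g.inner x (g.nabla F.normal (e.e I) x) (e.e J x) = 0
    rw [h, map_smul, smul_apply, e.pair_normal, smul_zero]
  · intro h I x
    rw [e.frame.expand (g.nabla F.normal (e.e I) x), Fin.sum_univ_succ, Finset.sum_eq_zero,
      add_zero]
    · have h2 : g.inner x (g.nabla F.normal (e.e I) x) (F.normal x) = -e.D I F.lnN x :=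
        congrFun (e.conn_zero_succ_zero I) x
      simp [LorentzMetric.TangentFrame.coeff, h2, D]
    · intro J _
      have : g.inner x (g.nabla F.normal (e.e I) x) (e.e J x) = 0 := h I J x
      simp [LorentzMetric.TangentFrame.coeff, this]

/-! ### The components of the curvature in a Fermi--Walker frame -/

section FermiWalker

variable {e}

theorem conn_zero_succ_succ (h : e.IsFermiWalker) (I J : Fin 3) :
    e.frame.conn 0 I.succ J.succ = fun _ ↦ 0 := by
  ext1 x; exact e.isFermiWalker_iff.1 h I J x

theorem riem_normal_normal (h : e.IsFermiWalker) (I J : Fin 3) (x : M) :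
    e.frame.riem 0 I.succ 0 J.succ x = F.normal.deriv (e.k I J) x - e.D I (e.D J F.lnN) x
      + (∑ K, e.D K F.lnN x * e.Γ I J K x) - e.D I F.lnN x * e.D J F.lnN x
      + ∑ K, e.k I K x * e.k K J x := by
  rw [e.frame.riem_eq]
  simp only [Fin.sum_univ_succ (n := 3), conn_succ_zero_succ, conn_succ_succ_succ, conn_self,
    conn_succ_succ_zero, conn_zero_succ_zero, conn_zero_zero_succ, conn_zero_succ_succ h,
    frame_b_zero, frame_b_succ, frame_ε_zero, frame_ε_succ]
  simp only [zero_mul, mul_zero, Finset.sum_const_zero, one_mul, zero_sub, neg_mul,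
    Finset.sum_neg_distrib]
  simp only [D]
  ring

/-- The Gauss equation. -/
theorem riem_spatial (I J K L : Fin 3) (x : M) :
    e.frame.riem K.succ I.succ J.succ L.succ x = e.D K (e.Γ I J L) x - e.D I (e.Γ K J L) x
      + e.k I J x * e.k K L x - e.k K J x * e.k I L x
      - (∑ P, e.Γ I J P x * e.Γ K L P x) + (∑ P, e.Γ K J P x * e.Γ I L P x)
      - ∑ P, (e.Γ K I P x - e.Γ I K P x) * e.Γ P J L x := by
  rw [e.frame.riem_eq]
  simp only [Fin.sum_univ_succ (n := 3), conn_succ_succ_succ,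
    conn_succ_succ_zero, frame_b_succ, frame_ε_zero, frame_ε_succ]
  -- Symmetry of `k` kills the normal part of `[e_K, e_I]`, the only place where the rotation could
  -- enter.
  rw [e.k_symm I K]
  simp only [one_mul, D]
  ring

theorem riem_normal_spatial (h : e.IsFermiWalker) (I J K : Fin 3) (x : M) :
    e.frame.riem 0 I.succ J.succ K.succ x = F.normal.deriv (e.Γ I J K) x
      + e.k I J x * e.D K F.lnN x - e.D J F.lnN x * e.k I K x
      + ∑ L, e.k I L x * e.Γ L J K x := by
  have h0 := conn_zero_succ_succ h
  rw [e.frame.riem_eq]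
  simp only [Fin.sum_univ_succ (n := 3), conn_succ_zero_succ, conn_succ_succ_succ, conn_self,
    conn_succ_succ_zero, conn_zero_succ_zero, h0,
    frame_b_zero, frame_b_succ, frame_ε_zero, frame_ε_succ, VField.deriv_const]
  simp only [zero_mul, mul_zero, Finset.sum_const_zero, one_mul, zero_sub, neg_mul,
    Finset.sum_neg_distrib]
  ring

/-- The Codazzi equation; only derivatives tangent to the leaves occur. -/
theorem riem_codazzi (I J K : Fin 3) (x : M) :
    e.frame.riem J.succ K.succ 0 I.succ x = e.D J (e.k K I) x - e.D K (e.k J I) x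
      - (∑ L, e.k K L x * e.Γ J I L x) + (∑ L, e.k J L x * e.Γ K I L x)
      - ∑ L, (e.Γ J K L x - e.Γ K J L x) * e.k L I x := by
  rw [e.frame.riem_eq]
  simp only [Fin.sum_univ_succ (n := 3), conn_succ_zero_succ, conn_succ_succ_succ, conn_self,
    conn_succ_succ_zero, conn_zero_zero_succ, frame_b_succ, frame_ε_zero, frame_ε_succ]
  rw [e.k_symm K J]
  simp only [zero_mul, one_mul, D]
  ring

end FermiWalker

end OrthonormalFrame

end AdaptedFrame

/-! ### The reduced equations as curvature identities, the reference frame and the lapse. -/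

section Reduced

variable {M : Type*} [TopologicalSpace M] [ChartedSpace E4 M]
  [IsManifold (𝓡 4) ∞ M] {g : LorentzMetric M} {F : ZeroShiftFoliation g} {x : M}

namespace OrthonormalFrame

variable {e : OrthonormalFrame F}

theorem Γ_self (I J : Fin 3) (x : M) : e.Γ I J J x = 0 := by linarith [e.Γ_swap I J J x]

theorem Γ_swap_fun (I J K : Fin 3) : e.Γ I J K = fun x ↦ -e.Γ I K J x := by
  ext1 x; exact e.Γ_swap I J K x

theorem ric_succ (a : Fin 4) (I : Fin 3) (x : M) :
    e.frame.ric I.succ a x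
      = -e.frame.riem 0 I.succ a 0 x + ∑ K : Fin 3, e.frame.riem K.succ I.succ a K.succ x := by
  simp [LorentzMetric.TangentFrame.ric, Fin.sum_univ_succ (n := 3)]

/-- In `Ric_{IJ} = R(0,I,0,J) + Σ R(K,I,J,K)` the first term contains `e_0 k_{IJ}` and the second is
given by Gauss; the products `k_{IK} k_{KJ}` cancel between them. -/
theorem deriv_k_normal (h : e.IsFermiWalker) (I J : Fin 3) (x : M) :
    F.normal.deriv (e.k I J) x =
      -(∑ K, e.D K (e.Γ I J K) x) + (∑ K, e.D I (e.Γ K J K) x) + e.D I (e.D J F.lnN) x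
      - (∑ K, e.k K K x) * e.k I J x
      - (∑ K, ∑ L, e.Γ I J L x * e.Γ K L K x) + (∑ K, ∑ L, e.Γ K I L x * e.Γ L J K x)
      + e.D I F.lnN x * e.D J F.lnN x - (∑ K, e.Γ I J K x * e.D K F.lnN x)
      + e.frame.ric I.succ J.succ x := by
  have h1 := riem_normal_normal h I J x
  -- A normal form for the antisymmetric pair of indices, so that `ring` can match terms.
  have s10 := fun P ↦ e.Γ_swap P 1 0 x
  have s20 := fun P ↦ e.Γ_swap P 2 0 x
  have s21 := fun P ↦ e.Γ_swap P 2 1 x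
  rw [ric_succ, e.frame.riem_swap_right, h1]
  simp only [riem_spatial, Fin.sum_univ_three, s10, s20, s21, Γ_self]
  ring

/-- The components `R(0,I,0,I)`, which carry the time derivatives, cancel between `Ric_{00}` and `Σ
Ric_{II}`. What remains is the full spatial trace of the Gauss equation. -/
theorem gauss (e : OrthonormalFrame F) (x : M) :
    2 * (∑ I, ∑ K, e.D K (e.Γ I I K) x)
      + (∑ I, ∑ K, ∑ L, e.Γ I I L x * e.Γ K L K x)
      - (∑ I, ∑ K, ∑ L, e.Γ K I L x * e.Γ L I K x)
      + (∑ I, e.k I I x) ^ 2 - (∑ I, ∑ J, e.k I J x * e.k I J x) =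
    e.frame.ric 0 0 x + ∑ I : Fin 3, e.frame.ric I.succ I.succ x := by
  have h0 : e.frame.ric 0 0 x = -∑ I : Fin 3, e.frame.riem 0 I.succ 0 I.succ x := by
    have h1 : e.frame.riem 0 0 0 0 x = 0 := by linarith [e.frame.riem_swap_left 0 0 0 0 x]
    rw [LorentzMetric.TangentFrame.ric, Fin.sum_univ_succ (n := 3), h1, ← Finset.sum_neg_distrib]
    simp only [frame_ε_succ, one_mul, mul_zero, zero_add]
    exact Finset.sum_congr rfl fun I _ ↦ e.frame.riem_swap_left _ _ _ _ x
  have h1 : ∀ I : Fin 3, e.frame.riem 0 I.succ I.succ 0 x = -e.frame.riem 0 I.succ 0 I.succ x :=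
    fun I ↦ e.frame.riem_swap_right _ _ _ _ x
  have s10 := fun P ↦ e.Γ_swap P 1 0 x
  have s20 := fun P ↦ e.Γ_swap P 2 0 x
  have s21 := fun P ↦ e.Γ_swap P 2 1 x
  have d : ∀ I K, e.D I (e.Γ K I K) x = -e.D I (e.Γ K K I) x := fun I K ↦ by
    rw [Γ_swap_fun, D, VField.deriv_neg]; rfl
  have z : ∀ I K, e.D I (e.Γ K K K) x = 0 := fun I K ↦ by
    have : e.Γ K K K = fun _ ↦ 0 := by ext1 y; exact Γ_self K K y
    rw [this, D, VField.deriv_const]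
  rw [h0]
  simp only [ric_succ, h1, neg_neg, Finset.sum_add_distrib]
  simp only [riem_spatial, d]
  simp only [Fin.sum_univ_three, s10, s20, s21, Γ_self, z, e.k_symm 1 0, e.k_symm 2 0,
    e.k_symm 2 1]
  ring

/-- The contracted Codazzi equation; the normal summand `R(0,I,0,0)` vanishes by antisymmetry. -/
theorem codazzi (I : Fin 3) (x : M) :
    (∑ J, e.D J (e.k J I) x) - (∑ J, ∑ K, e.Γ J J K x * e.k K I x)
      - (∑ J, ∑ K, e.Γ J I K x * e.k J K x) - e.D I (fun y ↦ ∑ J, e.k J J y) x =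
    e.frame.ric I.succ 0 x := by
  have h0 : e.frame.riem 0 I.succ 0 0 x = 0 := by linarith [e.frame.riem_swap_right 0 I.succ 0 0 x]
  have hd : e.D I (fun y ↦ ∑ J, e.k J J y) x = ∑ J, e.D I (e.k J J) x :=
    VField.deriv_sum fun J _ ↦ e.smoothFunAt_k J J x
  have s10 := fun P ↦ e.Γ_swap P 1 0 x
  have s20 := fun P ↦ e.Γ_swap P 2 0 x
  have s21 := fun P ↦ e.Γ_swap P 2 1 x
  rw [ric_succ, h0, hd]
  simp only [riem_codazzi, e.k_symm I, Fin.sum_univ_three, s10, s20, s21, Γ_self, e.k_symm 1 0,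
    e.k_symm 2 0, e.k_symm 2 1]
  ring

/-- By pair symmetry `R(0,I,J,K)`, which contains `e_0 Γ_{IJK}`, equals the Codazzi expression for
`R(J,K,0,I)`. -/
theorem deriv_Γ_normal (h : e.IsFermiWalker) (I J K : Fin 3) (x : M) :
    F.normal.deriv (e.Γ I J K) x =
      e.D J (e.k K I) x - e.D K (e.k J I) x
      + (∑ L, e.k K L x * e.Γ J L I x) - (∑ L, e.k J L x * e.Γ K L I x)
      - (∑ L, e.k I L x * e.Γ J K L x) + (∑ L, e.k I L x * e.Γ K J L x)
      - (∑ L, e.k I L x * e.Γ L J K x)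
      + e.D J F.lnN x * e.k I K x - e.D K F.lnN x * e.k I J x := by
  have h1 := riem_normal_spatial h I J K x
  rw [e.frame.riem_pair_symm, riem_codazzi] at h1
  have s : ∀ J L, e.Γ J L I x = -e.Γ J I L x := fun J L ↦ e.Γ_swap J L I x
  have s' : ∀ L, e.k L I = e.k I L := fun L ↦ e.k_symm L I
  have e1 : ∑ L, e.k K L x * e.Γ J L I x = -∑ L, e.k K L x * e.Γ J I L x := by
    rw [← Finset.sum_neg_distrib]
    exact Finset.sum_congr rfl fun L _ ↦ by rw [s, mul_neg]
  have e2 : ∑ L, e.k J L x * e.Γ K L I x = -∑ L, e.k J L x * e.Γ K I L x := by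
    rw [← Finset.sum_neg_distrib]
    exact Finset.sum_congr rfl fun L _ ↦ by rw [s, mul_neg]
  have e3 : ∑ L, (e.Γ J K L x - e.Γ K J L x) * e.k L I x
      = (∑ L, e.k I L x * e.Γ J K L x) - ∑ L, e.k I L x * e.Γ K J L x := by
    rw [← Finset.sum_sub_distrib]
    exact Finset.sum_congr rfl fun L _ ↦ by rw [s']; ring
  rw [e1, e2]
  rw [e3] at h1
  linarith

theorem box_eq {f : M → ℝ} (hf : SmoothFunAt f x) :
    g.box f x = -F.normal.deriv (F.normal.deriv f) x + (∑ I, e.D I (e.D I f) x)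
      - (∑ I, e.k I I x) * F.normal.deriv f x - (∑ I, ∑ J, e.Γ I I J x * e.D J f x)
      + ∑ I, e.D I f x * e.D I F.lnN x := by
  rw [e.frame.box_eq hf]
  simp only [Fin.sum_univ_succ (n := 3), conn_succ_succ_succ, conn_self,
    conn_succ_succ_zero, conn_zero_zero_succ, frame_b_zero, frame_b_succ, frame_ε_zero,
    frame_ε_succ, D, Fin.sum_univ_three]
  ring

/-! ### The reference frame -/

variable (e) (R : ReferenceFrame F)

theorem expand_tangent {v : TangentSpace (𝓡 4) x} (hv : mvfderiv (𝓡 4) F.t x v = 0) :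
    v = ∑ I, g.inner x v (e.e I x) • e.e I x := by
  conv_lhs => rw [e.frame.expand v, Fin.sum_univ_succ]
  have : g.inner x v (F.normal x) = 0 := by rw [g.symm, F.inner_normal, hv, mul_zero]
  simp [LorentzMetric.TangentFrame.coeff, this]

/-- On tangent vectors the dual coframe is metric pairing with `e_I`; the coefficients are thus
smooth although the forms are not assumed to be. -/
theorem coframeCoeff_eq (I i : Fin 3) : e.coframeCoeff R I i = g.pair (R.E i) (e.e I) := by
  ext1 x
  rw [coframeCoeff]
  conv_lhs => rw [e.expand_tangent (R.tangent i x)]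
  simp [e.dual, LorentzMetric.pair]

theorem θ_eq : R.θ = fun x ↦ ∑ I, e.k I I x := by
  ext1 x
  rw [ReferenceFrame.θ, g.metricTrace_eq_sum (f := fun I ↦ e.e I x) (δ := fun _ ↦ 1)
    (P := fun i I ↦ g.inner x (R.E i x) (e.e I x)) (by simp) (fun I J ↦ e.orthonormal I J x)
    (fun i ↦ e.expand_tangent (R.tangent i x)) (R.linearIndependent x)]
  · simp only [one_mul]; rfl
  · intro i j
    conv_lhs => rw [e.expand_tangent (R.tangent i x), e.expand_tangent (R.tangent j x)]
    simp only [ZeroShiftFoliation.k, map_sum, sum_apply, map_smul, smul_apply, smul_eq_mul,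
      Finset.mul_sum]
    rw [Finset.sum_comm]
    exact Finset.sum_congr rfl fun a _ ↦ Finset.sum_congr rfl fun c _ ↦ by ring

/-- The matrix of the reference frame in the orthonormal frame. -/
def refMatrix (x : M) : Matrix (Fin 3) (Fin 3) ℝ := fun i I ↦ g.pair (R.E i) (e.e I) x

theorem smoothFunAt_refMatrix (i I : Fin 3) (x : M) :
    SmoothFunAt (fun y ↦ e.refMatrix R y i I) x :=
  g.smoothFunAt_pair (R.smooth i x) (e.smoothAt I x)

theorem refMatrix_mul (x : M) :
    e.refMatrix R x * Matrix.of (fun I j ↦ e.frameCoeff R I j x) = 1 := by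
  ext i j
  have h : R.η j x (R.E i x) = _ := congrArg (R.η j x) (e.expand_tangent (R.tangent i x))
  rw [R.dual] at h
  simp only [map_sum, map_smul, smul_eq_mul] at h
  simp only [Matrix.mul_apply, Matrix.one_apply, eq_comm (a := i)]
  exact h.symm

theorem mul_refMatrix (x : M) :
    Matrix.of (fun I j ↦ e.frameCoeff R I j x) * e.refMatrix R x = 1 :=
  mul_eq_one_comm.1 (e.refMatrix_mul R x)

theorem _root_.SmoothFunAt.det {A : M → Matrix (Fin 3) (Fin 3) ℝ}
    (hA : ∀ i j, SmoothFunAt (fun y ↦ A y i j) x) : SmoothFunAt (fun y ↦ (A y).det) x := by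
  simp only [Matrix.det_fin_three]
  have h3 := fun i j k l m n ↦ ((hA i j).mul (hA k l)).mul (hA m n)
  exact ((((((h3 0 0 1 1 2 2).sub (h3 0 0 1 2 2 1)).sub (h3 0 1 1 0 2 2)).add
    (h3 0 1 1 2 2 0)).add (h3 0 2 1 0 2 1)).sub (h3 0 2 1 1 2 0))

/-- The `η^i` need not be smooth, but these coefficients form the inverse of the smooth matrix
`refMatrix`, so Cramer's rule applies. -/
theorem smoothFunAt_frameCoeff (I i : Fin 3) (x : M) : SmoothFunAt (e.frameCoeff R I i) x := by
  have h : e.frameCoeff R I i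
      = fun y ↦ ((e.refMatrix R y).det)⁻¹ * (e.refMatrix R y).adjugate I i := by
    ext1 y
    have := congrFun (congrFun (Matrix.inv_eq_right_inv (e.refMatrix_mul R y)) I) i
    rw [Matrix.inv_def, Matrix.smul_apply, Ring.inverse_eq_inv', smul_eq_mul] at this
    exact this.symm
  have hd : (e.refMatrix R x).det ≠ 0 := by
    intro h0
    have := congrArg Matrix.det (e.refMatrix_mul R x)
    rw [Matrix.det_mul, h0, zero_mul, Matrix.det_one] at this
    exact zero_ne_one this
  rw [h]
  refine ((SmoothFunAt.det fun i j ↦ e.smoothFunAt_refMatrix R i j x).inv hd).mul ?_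
  simp only [Matrix.adjugate_apply]
  refine SmoothFunAt.det fun k l ↦ ?_
  by_cases hk : k = i
  · subst hk
    simp only [Matrix.updateRow_self]
    exact SmoothFunAt.const _ x
  · simp only [Matrix.updateRow_ne hk]
    exact e.smoothFunAt_refMatrix R k l x

/-- Compatibility gives `g(∇_{e_0} E_i, e_I) + g(E_i, ∇_{e_0} e_I)`. The second term is the
rotation; in the first, `∇_{e_0} E_i` may be replaced by `∇_{E_i} e_0`, giving `k`. -/
theorem deriv_refMatrix (i I : Fin 3) (x : M) :
    F.normal.deriv (fun y ↦ e.refMatrix R y i I) x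
      = ∑ J, (e.k I J x + e.rot I J x) * e.refMatrix R x i J := by
  have hE := R.smooth i x
  have h := g.deriv_pair (F.smoothAt_normal x).diffAt (VField.SmoothAt.diffAt hE)
    (e.smoothAt I x).diffAt
  have h1 := g.nabla_sub_nabla (F.smoothAt_normal x).diffAt (VField.SmoothAt.diffAt hE)
  -- From `[∂_t, E_i] = 0` the bracket `[e_0, E_i]` is a multiple of `∂_t`, hence normal to the
  -- leaf.
  have hb : g.inner x (F.normal.bracket (R.E i) x) (e.e I x) = 0 := by
    have : F.normal.bracket (R.E i) x = -(R.E i).deriv (fun y ↦ (F.N y)⁻¹) x • F.partialT x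
        + (F.N x)⁻¹ • F.partialT.bracket (R.E i) x :=
      mlieBracket_smul_left (SmoothFunAt.inv (F.N_smooth x) (F.N_pos x).ne').mdiff
        (VField.SmoothAt.diffAt (F.partialT_smooth x))
    have ht : mvfderiv (𝓡 4) F.t x (e.e I x) = 0 := e.tangent I x
    rw [this, R.commute]
    simp [F.inner_partialT, ht]
  have hp0 : g.pair (R.E i) F.normal x = 0 := by
    have : mvfderiv (𝓡 4) F.t x (R.E i x) = 0 := R.tangent i x
    rw [g.pair_comm, LorentzMetric.pair, F.inner_normal, this, mul_zero]
  have h2 : g.pair (g.nabla (R.E i) F.normal) (e.e I) x = ∑ J, e.refMatrix R x i J * e.k J I x := by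
    have := e.frame.pair_nabla_left (x := x) F.normal I.succ (R.E i)
    rw [Fin.sum_univ_succ (n := 3)] at this
    simp only [frame_b_zero, frame_b_succ, hp0, zero_mul, mul_zero, zero_add, frame_ε_succ,
      one_mul] at this
    exact this
  have h3 : g.pair (R.E i) (g.nabla F.normal (e.e I)) x = ∑ J, e.refMatrix R x i J * e.rot I J x := by
    have := e.frame.inner_nabla (x := x) (R.E i) 0 I.succ
    rw [Fin.sum_univ_succ (n := 3)] at this
    simp only [frame_b_zero, frame_b_succ, hp0, zero_mul, mul_zero, zero_add, frame_ε_succ,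
      one_mul] at this
    exact this
  have h4 : g.pair (g.nabla F.normal (R.E i)) (e.e I) x
      = g.pair (g.nabla (R.E i) F.normal) (e.e I) x := by
    rw [← h1, map_sub, sub_apply, sub_eq_zero] at hb
    exact hb
  have h5 : F.normal.deriv (fun y ↦ e.refMatrix R y i I) x
      = F.normal.deriv (g.pair (R.E i) (e.e I)) x := rfl
  rw [h5, h, h4, h2, h3, ← Finset.sum_add_distrib]
  exact Finset.sum_congr rfl fun J _ ↦ by rw [e.k_symm J I]; ring

/-- Differentiating `C W = 1` with `W' = W A` gives `C' = -A C`. -/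
theorem deriv_frameCoeff (I j : Fin 3) (x : M) :
    F.normal.deriv (e.frameCoeff R I j) x
      = ∑ J, (-e.k I J x + e.rot I J x) * e.frameCoeff R J j x := by
  set C : Matrix (Fin 3) (Fin 3) ℝ := Matrix.of (fun I j ↦ e.frameCoeff R I j x) with hC
  set C' : Matrix (Fin 3) (Fin 3) ℝ :=
    Matrix.of (fun I j ↦ F.normal.deriv (e.frameCoeff R I j) x) with hC'
  set W := e.refMatrix R x with hW
  -- The indices are transposed so that `W' = W A`; in `-A C` this changes the sign of the
  -- antisymmetric rotation back to plus.
  set A : Matrix (Fin 3) (Fin 3) ℝ := Matrix.of (fun J I ↦ e.k I J x + e.rot I J x) with hA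
  have hWA : ∀ i I, F.normal.deriv (fun y ↦ e.refMatrix R y i I) x = (W * A) i I := by
    intro i I
    rw [e.deriv_refMatrix R i I x, Matrix.mul_apply]
    exact Finset.sum_congr rfl fun J _ ↦ mul_comm _ _
  have h : C' * W + C * (W * A) = 0 := by
    ext I J
    have h1 : (fun y ↦ ∑ i, e.frameCoeff R I i y * e.refMatrix R y i J)
        = fun _ ↦ (1 : Matrix (Fin 3) (Fin 3) ℝ) I J := by
      ext1 y
      exact congrFun (congrFun (e.mul_refMatrix R y) I) J
    have h2 := VField.deriv_const (X := F.normal) (x := x) ((1 : Matrix (Fin 3) (Fin 3) ℝ) I J)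
    rw [← h1, VField.deriv_sum (f := fun i y ↦ e.frameCoeff R I i y * e.refMatrix R y i J)
      fun i _ ↦ (e.smoothFunAt_frameCoeff R I i x).mul (e.smoothFunAt_refMatrix R i J x)] at h2
    rw [Matrix.add_apply, Matrix.mul_apply, Matrix.mul_apply, ← Finset.sum_add_distrib,
      Matrix.zero_apply, ← h2]
    refine Finset.sum_congr rfl fun i _ ↦ ?_
    rw [VField.deriv_mul (e.smoothFunAt_frameCoeff R I i x) (e.smoothFunAt_refMatrix R i J x), hWA]
    simp only [hC', hC, Matrix.of_apply]
    ring
  have h3 : C' = -(A * C) := by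
    have h4 : C' * W = -A := by
      rw [← Matrix.mul_assoc, e.mul_refMatrix R x, Matrix.one_mul] at h
      exact eq_neg_of_add_eq_zero_left h
    calc C' = C' * (W * C) := by rw [e.refMatrix_mul R x, Matrix.mul_one]
      _ = -(A * C) := by rw [← Matrix.mul_assoc, h4, Matrix.neg_mul]
  have h5 := congrFun (congrFun h3 I) j
  rw [Matrix.neg_apply, Matrix.mul_apply, ← Finset.sum_neg_distrib] at h5
  refine h5.trans (Finset.sum_congr rfl fun J _ ↦ ?_)
  have : e.rot I J x = -e.rot J I x := e.frame.conn_swap _ _ _ x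
  simp only [hA, hC, Matrix.of_apply]
  rw [this, e.k_symm I J]
  ring

/-- The frame equation fails by the rotation matrix times the invertible matrix of coefficients. -/
theorem isFermiWalker_iff_frame : e.IsFermiWalker ↔ ∀ I i x,
    F.normal.deriv (e.frameCoeff R I i) x = -∑ J, e.k I J x * e.frameCoeff R J i x := by
  have key : ∀ I i x, F.normal.deriv (e.frameCoeff R I i) x
      = -(∑ J, e.k I J x * e.frameCoeff R J i x) + ∑ J, e.rot I J x * e.frameCoeff R J i x := by
    intro I i x
    rw [e.deriv_frameCoeff, ← Finset.sum_neg_distrib, ← Finset.sum_add_distrib]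
    exact Finset.sum_congr rfl fun J _ ↦ by ring
  rw [e.isFermiWalker_iff]
  constructor
  · intro h I i x
    rw [key]
    simp [h]
  · intro h I J x
    have h1 : (Matrix.of fun I J ↦ e.rot I J x)
        * Matrix.of (fun I j ↦ e.frameCoeff R I j x) = 0 := by
      ext I i
      have := h I i x
      rw [key] at this
      rw [Matrix.mul_apply, Matrix.zero_apply]
      simp only [Matrix.of_apply]
      linarith
    have h2 := congrArg (fun A ↦ A * e.refMatrix R x) h1
    simp only [Matrix.mul_assoc, e.mul_refMatrix R x, Matrix.mul_one, Matrix.zero_mul] at h2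
    exact congrFun (congrFun h2 I) J

theorem deriv_coframeCoeff (h : e.IsFermiWalker) (I i : Fin 3) (x : M) :
    F.normal.deriv (e.coframeCoeff R I i) x = ∑ J, e.k I J x * e.coframeCoeff R J i x := by
  simp only [coframeCoeff_eq]
  have := e.deriv_refMatrix R i I x
  simp only [e.isFermiWalker_iff.1 h, add_zero] at this
  exact this

/-- `ln t` is constant on the leaves and `e_0 ln t = 1 / (t N)`, so only `e_0` derivatives
contribute. -/
theorem box_log_t (R : ReferenceFrame F) (e : OrthonormalFrame F) (x : M) : g.box (fun y ↦ Real.log (F.t y)) x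
    = 1 / (F.t x * F.N x ^ 2)
      * (F.normal.deriv F.N x - (F.N x * R.θ x - 1 / F.t x)) := by
  have ht := fun y ↦ (F.t_pos y).ne'
  have hN := fun y ↦ (F.N_pos y).ne'
  have hD : ∀ I, e.D I (fun y ↦ Real.log (F.t y)) = fun _ ↦ 0 := fun I ↦ by
    ext1 y
    rw [D, VField.deriv_comp (Real.hasDerivAt_log (ht y)) (F.t_smooth y), e.deriv_t, mul_zero]
  have h0 : F.normal.deriv (fun y ↦ Real.log (F.t y)) = fun y ↦ (F.t y)⁻¹ * (F.N y)⁻¹ := by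
    ext1 y
    rw [VField.deriv_comp (Real.hasDerivAt_log (ht y)) (F.t_smooth y), F.deriv_normal_t]
  have h1 : F.normal.deriv (fun y ↦ (F.t y)⁻¹ * (F.N y)⁻¹) x
      = (F.t x)⁻¹ * (-(F.N x ^ 2)⁻¹ * F.normal.deriv F.N x)
        + (F.N x)⁻¹ * (-(F.t x ^ 2)⁻¹ * (F.N x)⁻¹) := by
    rw [VField.deriv_mul (SmoothFunAt.inv (F.t_smooth x) (ht x))
      (SmoothFunAt.inv (F.N_smooth x) (hN x)),
      VField.deriv_comp (F := fun r ↦ r⁻¹) (hasDerivAt_inv (hN x)) (F.N_smooth x),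
      VField.deriv_comp (F := fun r ↦ r⁻¹) (hasDerivAt_inv (ht x)) (F.t_smooth x),
      F.deriv_normal_t]
  rw [box_eq (e := e) (SmoothFunAt.log (F.t_smooth x) (ht x)), h0, h1, e.θ_eq R]
  have hD' : ∀ I, e.D I (fun _ ↦ 0) x = 0 := fun I ↦ VField.deriv_const 0
  simp only [hD, hD', zero_mul, mul_zero, Finset.sum_const_zero]
  have := ht x
  have := hN x
  field_simp
  ring

/-- After cancelling the nonzero prefactor, the term `-(N θ - 1 / t)` of `□ ln t` moves across and
turns `𝔞` into `𝔞 + 1`. -/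
theorem timeEquation_iff (R : ReferenceFrame F) (e : OrthonormalFrame F) (𝔞 : ℝ) : R.TimeEquation 𝔞 ↔
    ∀ x, F.normal.deriv F.N x = (𝔞 + 1) * (F.N x * R.θ x - 1 / F.t x) := by
  refine forall_congr' fun x ↦ ?_
  rw [e.box_log_t R x]
  have h : 1 / (F.t x * F.N x ^ 2) ≠ 0 :=
    one_div_ne_zero (mul_ne_zero (F.t_pos x).ne' (pow_ne_zero 2 (F.N_pos x).ne'))
  rw [div_eq_mul_one_div 𝔞, mul_comm 𝔞, mul_assoc, mul_right_inj' h]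
  constructor <;> intro h <;> linarith

end OrthonormalFrame

end Reduced

end

/-! ### The equivalence. -/

theorem mainTheorem7 {M : Type*} [TopologicalSpace M] [T2Space M] [SecondCountableTopology M]
    [ChartedSpace E4 M] [IsManifold (𝓡 4) ∞ M] (g : LorentzMetric M)
    (F : ZeroShiftFoliation g) (R : ReferenceFrame F) (e : OrthonormalFrame F)
    (φ : M → ℝ) (hφ : SmoothFun φ) (V : ℝ → ℝ) (hV : ContDiff ℝ ∞ V) (𝔞 : ℝ) (h𝔞 : 0 < 𝔞) :
    (g.SolvesENSF V φ ∧ R.TimeEquation 𝔞 ∧ e.IsFermiWalker) ↔ e.ReducedEquations R 𝔞 V φ := by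
  have hθ := e.θ_eq R
  have hbox : ∀ x, g.box φ x = deriv V (φ x) ↔
      F.normal.deriv (F.normal.deriv φ) x =
        (∑ I, e.D I (e.D I φ) x) - R.θ x * F.normal.deriv φ x
        - (∑ I, ∑ J, e.Γ I I J x * e.D J φ x) + (∑ I, e.D I φ x * e.D I F.lnN x)
        - deriv V (φ x) := by
    intro x
    rw [OrthonormalFrame.box_eq (e := e) (hφ x), hθ]
    constructor <;> intro h <;> linarith
  constructor
  · rintro ⟨⟨hE, hw⟩, ht, hF⟩
    have hR := fun x ↦ (e.frame.einstein_iff V φ).1 (hE x)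
    refine ⟨(e.isFermiWalker_iff_frame R).1 hF, e.deriv_coframeCoeff R hF,
      (e.timeEquation_iff R 𝔞).1 ht, fun I J x ↦ ?_, OrthonormalFrame.deriv_Γ_normal hF,
      fun x ↦ (hbox x).1 (hw x), fun x ↦ ?_, fun I x ↦ ?_⟩
    · rw [OrthonormalFrame.deriv_k_normal hF, hR, hθ]
      simp only [OrthonormalFrame.frame_b_succ, OrthonormalFrame.frame_ε_succ, Fin.succ_inj,
        OrthonormalFrame.D]
      ring
    · rw [hθ, OrthonormalFrame.gauss]
      simp only [hR, OrthonormalFrame.frame_b_succ, OrthonormalFrame.frame_ε_succ,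
        OrthonormalFrame.frame_b_zero, OrthonormalFrame.frame_ε_zero, if_true,
        OrthonormalFrame.D, Fin.sum_univ_three]
      ring
    · rw [hθ, OrthonormalFrame.codazzi, hR]
      simp only [OrthonormalFrame.frame_b_succ, OrthonormalFrame.frame_b_zero,
        Fin.succ_ne_zero, if_false, OrthonormalFrame.D]
      ring
  · intro h
    -- Recovered first, since the identity for `e_0 k_{IJ}` presupposes it.
    have hF := (e.isFermiWalker_iff_frame R).2 h.frame
    have hs : ∀ I J x, e.frame.ric I.succ J.succ x
        = e.D I φ x * e.D J φ x + V (φ x) * (if I = J then 1 else 0) := by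
      intro I J x
      have h1 := h.evolution_k I J x
      rw [OrthonormalFrame.deriv_k_normal hF, hθ] at h1
      linarith
    -- The spatial components already account for `Σ (e_I φ)² + 3 V` of the Hamiltonian constraint,
    -- leaving `(e_0 φ)² - V`.
    have h0 : ∀ x, e.frame.ric 0 0 x = F.normal.deriv φ x ^ 2 - V (φ x) := by
      intro x
      have h1 := h.hamiltonian x
      rw [hθ, OrthonormalFrame.gauss] at h1
      simp only [hs, if_true, Fin.sum_univ_three] at h1
      linarith
    have hm : ∀ I x, e.frame.ric I.succ 0 x = F.normal.deriv φ x * e.D I φ x := by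
      intro I x
      have h1 := h.momentum I x
      rwa [hθ, OrthonormalFrame.codazzi] at h1
    refine ⟨⟨fun x ↦ (e.frame.einstein_iff V φ).2 fun a c ↦ ?_, fun x ↦ (hbox x).2 (h.wave x)⟩,
      (e.timeEquation_iff R 𝔞).2 h.lapse, hF⟩
    refine Fin.cases ?_ (fun I ↦ ?_) a <;> refine Fin.cases ?_ (fun J ↦ ?_) c
    · rw [h0]
      simp only [OrthonormalFrame.frame_b_zero, OrthonormalFrame.frame_ε_zero, if_true]
      ring
    · rw [e.frame.ric_symm, hm]
      simp [(Fin.succ_ne_zero J).symm, OrthonormalFrame.D]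
    · rw [hm]
      simp [OrthonormalFrame.D, mul_comm]
    · rw [hs]
      simp [OrthonormalFrame.D]
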